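/- Let $\Omega$, $M$, $A$ be finite sets of states, messages and actions with $|M|\ge\min\{|\Omega|,|A|\}$, let $u_S,u_R:\Omega\times A\to\mathbb R$ be the payoff functions of a sender and a receiver, and let $\mu\in\Delta(\Omega)$. **Dynamic game.** The states $\omega_1,\omega_2,\dots$ are i.i.d. with distribution $\mu$. In each period $n\ge 1$ the sender observes $\omega_n$ and sends a message $m_n\in M$; the receiver observes $m_n$ (but not $\omega_n$) and chooses an action $a_n\in A$, which the sender does not observe. No player observes payoffs. A strategy of the sender is a sequence $\sigma=(\sigma_n)_{n\ge1}$ of maps $\sigma_n:(\Omega\times M)^{n-1}\times\Omega\to\Delta(M)$, and a strategy of the receiver is a sequence $\tau=(\tau_n)_{n\ge1}$ of maps $\tau_n:(M\times A)^{n-1}\times M\to\Delta(A)$. For $\delta\in(0,1)$ and $i\in\{S,R\}$ let $$\gamma_i^\delta(\sigma,\tau)=\mathbb E_{\sigma,\tau}\Big[(1-\delta)\sum_{n=1}^\infty\delta^{n-1}u_i(\omega_n,a_n)\Big].$$ A vector $\gamma=(\gamma_S,\gamma_R)\in\mathbb R^2$ is a *uniform equilibrium payoff* if for every $\epsilon>0$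 there exist $\delta_0\in(0,1)$ and a strategy profile $(\sigma^*,\tau^*)$ such that for all $\delta\in[\delta_0,1)$: $\gamma_S^\delta(\tilde\sigma,\tau^*)\le\gamma_S^\delta(\sigma^*,\tau^*)+\epsilon$ for all $\tilde\sigma$, $\gamma_R^\delta(\sigma^*,\tilde\tau)\le\gamma_R^\delta(\sigma^*,\tau^*)+\epsilon$ for all $\tilde\tau$, and $\|\gamma^\delta(\sigma^*,\tau^*)-\gamma\|_\infty\le\epsilon$. Let $\mathcal U$ be the set of uniform equilibrium payoffs. **Static model with partial commitment.** For $\lambda\in\Delta(M)$ let $\Sigma(\mu,\lambda)$ be the set of families $(p_m)_{m\in M}$ in $\Delta(\Omega)$ with $\sum_m\lambda(m)p_m=\mu$. Let $\mathcal E(\mu,\lambda)\subseteq\mathbb R^2$ be the set of payoff vectors $$\Big(\sum_{m}\lambda(m)\sum_{\omega}p_m(\omega)\sum_{a}\kappa(a\mid m)\,u_i(\omega,a)\Big)_{i=S,R}$$ over all $(p_m)_{m\in M}\in\Sigma(\mu,\lambda)$ and $\kappa:M\to\Delta(A)$ such that - (receiver) for every $m$ with $\lambda(m)>0$, every action in the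 support of $\kappa(\cdot\mid m)$ maximizes $b\mapsto\sum_\omega p_m(\omega)u_R(\omega,b)$ over $A$; - (sender) $\sum_m\lambda(m)\sum_\omega\big(p_m(\omega)-\tilde p_m(\omega)\big)\sum_a\kappa(a\mid m)u_S(\omega,a)\ge0$ for every $(\tilde p_m)_{m\in M}\in\Sigma(\mu,\lambda)$. **Claim.** The set of uniform equilibrium payoffs is the convex hull of the union of these sets over all message marginals: $$\mathcal U=\mathrm{Co}\Big(\bigcup_{\lambda\in\Delta(M)}\mathcal E(\mu,\lambda)\Big).$$ -/

import Mathlib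

namespace Persuasion

/-! ### The static persuasion model with partial commitment -/

section Static

variable {Ω M A : Type*} [Fintype Ω] [Fintype M] [Fintype A]

/-- Bayes plausibility of a collection of posterior beliefs `p` with weights `lam`, for the
prior `pri`: the posteriors average out to the prior. -/
def BayesPlausible (pri : stdSimplex ℝ Ω) (lam : stdSimplex ℝ M)
    (p : M → stdSimplex ℝ Ω) : Prop :=
  ∀ ω : Ω, ∑ m, lam.1 m * (p m).1 ω = pri.1 ω

/-- Expected payoff, for the payoff function `u`, when message `m` has probability `lam m`, the
state is distributed as `p m` after `m`, and the action as `κ m` after `m`. -/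
def staticPayoff (u : Ω → A → ℝ) (lam : stdSimplex ℝ M) (p : M → stdSimplex ℝ Ω)
    (κ : M → stdSimplex ℝ A) : ℝ :=
  ∑ m, lam.1 m * ∑ ω, (p m).1 ω * ∑ a, (κ m).1 a * u ω a

/-- The best responses of the receiver at the belief `p`. -/
def bestResponses (uR : Ω → A → ℝ) (p : stdSimplex ℝ Ω) : Set A :=
  {a | ∀ b : A, ∑ ω, p.1 ω * uR ω b ≤ ∑ ω, p.1 ω * uR ω a}

/-- Receiver's equilibrium condition: after every message of positive probability, the response
rule only uses best responses to the posterior. -/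
def ReceiverOptimal (uR : Ω → A → ℝ) (lam : stdSimplex ℝ M) (p : M → stdSimplex ℝ Ω)
    (κ : M → stdSimplex ℝ A) : Prop :=
  ∀ m : M, 0 < lam.1 m → Function.support (κ m).1 ⊆ bestResponses uR (p m)

/-- Sender's equilibrium condition: no other Bayes-plausible collection of posteriors with the
same weights gives her more against the response rule. -/
def SenderOptimal (uS : Ω → A → ℝ) (pri : stdSimplex ℝ Ω) (lam : stdSimplex ℝ M)
    (p : M → stdSimplex ℝ Ω) (κ : M → stdSimplex ℝ A) : Prop :=
  ∀ q : M → stdSimplex ℝ Ω, BayesPlausible pri lam q →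
    0 ≤ ∑ m, lam.1 m * ∑ ω, ((p m).1 ω - (q m).1 ω) * ∑ a, (κ m).1 a * uS ω a

/-- The set of equilibrium payoffs (sender, receiver) of the persuasion model with partial
commitment, for the prior `pri` and the message marginal `lam`. -/
def equilibriumPayoffs (uS uR : Ω → A → ℝ) (pri : stdSimplex ℝ Ω) (lam : stdSimplex ℝ M) :
    Set (ℝ × ℝ) :=
  {e | ∃ (p : M → stdSimplex ℝ Ω) (κ : M → stdSimplex ℝ A),
      BayesPlausible pri lam p ∧ ReceiverOptimal uR lam p κ ∧ SenderOptimal uS pri lam p κ ∧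
      e = (staticPayoff uS lam p κ, staticPayoff uR lam p κ)}

end Static

/-! ### The dynamic game without feedback

Periods are numbered from `0`. -/

section Dynamic

/-- A strategy of the sender: for each period `n`, a distribution over messages as a function of
the `n` past pairs (state, message) and the current state. -/
abbrev SenderStrategy (Ω M : Type*) [Fintype M] : Type _ :=
  (n : ℕ) → (Fin n → Ω × M) → Ω → stdSimplex ℝ M

/-- A strategy of the receiver: for each period `n`, a distribution over actions as a function
of the `n` past pairs (message, action) and the current message. -/
abbrev ReceiverStrategy (M A : Type*) [Fintype A] : Type _ :=
  (n : ℕ) → (Fin n → M × A) → M → stdSimplex ℝ A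

variable {Ω M A : Type*} [Fintype Ω] [Fintype M] [Fintype A]

/-- The distribution of the state in period `n` given the past states, for the Markov chain with
initial distribution `init` and transition matrix `Q`, where `Q ω` is the distribution of the
next state when the current one is `ω`. -/
def stateLaw (init : stdSimplex ℝ Ω) (Q : Ω → stdSimplex ℝ Ω) :
    (n : ℕ) → (Fin n → Ω) → stdSimplex ℝ Ω
  | 0, _ => init
  | n + 1, past => Q (past (Fin.last n))

/-- The probability that the first `n` triples (state, message, action) are those listed in
`h`, when the players use `σ` and `τ`. -/
def historyProb (init : stdSimplex ℝ Ω) (Q : Ω → stdSimplex ℝ Ω) (σ : SenderStrategy Ω M)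
    (τ : ReceiverStrategy M A) : (n : ℕ) → (Fin n → Ω × M × A) → ℝ
  | 0, _ => 1
  | n + 1, h =>
    let past : Fin n → Ω × M × A := fun k => h k.castSucc
    let ω : Ω := (h (Fin.last n)).1
    let m : M := (h (Fin.last n)).2.1
    let a : A := (h (Fin.last n)).2.2
    historyProb init Q σ τ n past
      * (stateLaw init Q n (fun k => (past k).1)).1 ω
      * (σ n (fun k => ((past k).1, (past k).2.1)) ω).1 m
      * (τ n (fun k => ((past k).2.1, (past k).2.2)) m).1 a

/-- The expectation of `u (ω_n, a_n)`, where `ω_n` and `a_n` are the state and the action in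
period `n`. -/
def stagePayoff (u : Ω → A → ℝ) (init : stdSimplex ℝ Ω) (Q : Ω → stdSimplex ℝ Ω)
    (σ : SenderStrategy Ω M) (τ : ReceiverStrategy M A) (n : ℕ) : ℝ :=
  ∑ h : Fin (n + 1) → Ω × M × A,
    historyProb init Q σ τ (n + 1) h * u (h (Fin.last n)).1 (h (Fin.last n)).2.2

/-- The `δ`-discounted payoff, for the payoff function `u`. The stage payoffs are bounded, so
the series converges absolutely for `0 < δ < 1`, and it is the expectation of the discounted sum
of the realized payoffs. -/
noncomputable def discountedPayoff (u : Ω → A → ℝ) (init : stdSimplex ℝ Ω)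
    (Q : Ω → stdSimplex ℝ Ω) (δ : ℝ) (σ : SenderStrategy Ω M) (τ : ReceiverStrategy M A) : ℝ :=
  (1 - δ) * ∑' n : ℕ, δ ^ n * stagePayoff u init Q σ τ n

/-- The set of uniform equilibrium payoffs (sender, receiver) of the dynamic game with message
set `M`. The norm on `ℝ × ℝ` is the maximum norm. -/
def uniformEquilibriumPayoffs (M : Type*) [Fintype M] (uS uR : Ω → A → ℝ)
    (init : stdSimplex ℝ Ω) (Q : Ω → stdSimplex ℝ Ω) : Set (ℝ × ℝ) :=
  {γ | ∀ ε : ℝ, 0 < ε →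
      ∃ δ₀ : ℝ, 0 < δ₀ ∧ δ₀ < 1 ∧ ∃ (σ : SenderStrategy Ω M) (τ : ReceiverStrategy M A),
        ∀ δ : ℝ, δ₀ ≤ δ → δ < 1 →
          (∀ σ' : SenderStrategy Ω M,
            discountedPayoff uS init Q δ σ' τ ≤ discountedPayoff uS init Q δ σ τ + ε) ∧
          (∀ τ' : ReceiverStrategy M A,
            discountedPayoff uR init Q δ σ τ' ≤ discountedPayoff uR init Q δ σ τ + ε) ∧
          ‖(discountedPayoff uS init Q δ σ τ, discountedPayoff uR init Q δ σ τ) - γ‖ ≤ ε}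

end Dynamic

end Persuasion

/-! Conditionally on the messages, states and actions are independent. Hence every message history
carries a static profile: a messaging rule `ρ` and a response rule `κ`. In these terms a static
equilibrium is a pair in which `κ` is optimal against `ρ`, and `ρ` is optimal among the rules with
the same message law (`iUnion_equilibriumPayoffs`).

Upper bound: after each message history the sender may switch to a rule with the same message law
without being noticed, and the receiver may switch to any response. If `γ` lies outside the hull,
which is compact, a linear functional separates it strictly. By compactness (`exists_gain_bound`)
the functional exceeds the separating level at a static profile by at most a multiple of the gains
available there. Averaged over histories and discounted, these gains are small at an approximate
equilibrium, a contradiction.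

Lower bound: duality (`exists_price`) gives prices of messages such that a deviation from a static
equilibrium gains at most its expected price, up to `η`. The receiver adds up the prices, and
whenever the sum is positive he reads a message of positive price as one of nonpositive price
(`correctedResponse`). The sum stays bounded above, so no deviation has a significant long-run gain.
Under the prescribed rules prices have mean zero, and a second-moment estimate makes corrections
rare (`sum_isReplaced_le`). Playing static equilibria along a greedy schedule (`exists_schedule`)
yields convex combinations. -/

namespace Persuasion

open Filter Topology

/-! ### Static equilibria: posteriors and messaging rules -/

section Static

variable {Ω M A : Type*} [Fintype Ω] [Fintype M] [Fintype A]

/-- The expectation of `c ω m` when `ω` has law `μ` and `m` has law `ρ ω`. -/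
def expect (μ : stdSimplex ℝ Ω) (ρ : Ω → stdSimplex ℝ M) (c : Ω → M → ℝ) : ℝ :=
  ∑ ω, μ.1 ω * ∑ m, (ρ ω).1 m * c ω m

/-- The mean payoff in state `ω` after message `m` under the response rule `κ`. -/
def meanAction (u : Ω → A → ℝ) (κ : M → stdSimplex ℝ A) (ω : Ω) (m : M) : ℝ :=
  ∑ a, (κ m).1 a * u ω a

/-- The expected payoff when messages are sent according to the messaging rule `ρ`. -/
def rulePayoff (μ : stdSimplex ℝ Ω) (u : Ω → A → ℝ) (ρ : Ω → stdSimplex ℝ M)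
    (κ : M → stdSimplex ℝ A) : ℝ :=
  expect μ ρ (meanAction u κ)

/-- The law of the message under the messaging rule `ρ`. -/
def messageLaw (μ : stdSimplex ℝ Ω) (ρ : Ω → stdSimplex ℝ M) (m : M) : ℝ :=
  ∑ ω, μ.1 ω * (ρ ω).1 m

/-- Equilibria of the partial commitment model in terms of messaging rules: the sender cannot
gain without changing the law of the message, and the receiver cannot gain. -/
def IsRuleEquilibrium (μ : stdSimplex ℝ Ω) (uS uR : Ω → A → ℝ) (ρ : Ω → stdSimplex ℝ M)
    (κ : M → stdSimplex ℝ A) : Prop :=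
  (∀ ρ' : Ω → stdSimplex ℝ M, messageLaw μ ρ' = messageLaw μ ρ →
    rulePayoff μ uS ρ' κ ≤ rulePayoff μ uS ρ κ) ∧
  ∀ κ' : M → stdSimplex ℝ A, rulePayoff μ uR ρ κ' ≤ rulePayoff μ uR ρ κ

lemma expect_mono (μ : stdSimplex ℝ Ω) (ρ : Ω → stdSimplex ℝ M) {c d : Ω → M → ℝ}
    (h : ∀ ω m, c ω m ≤ d ω m) : expect μ ρ c ≤ expect μ ρ d :=
  Finset.sum_le_sum fun ω _ => mul_le_mul_of_nonneg_left
    (Finset.sum_le_sum fun m _ => mul_le_mul_of_nonneg_left (h ω m) ((ρ ω).2.1 m)) (μ.2.1 ω)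

lemma expect_add (μ : stdSimplex ℝ Ω) (ρ : Ω → stdSimplex ℝ M) (c d : Ω → M → ℝ) :
    expect μ ρ (fun ω m => c ω m + d ω m) = expect μ ρ c + expect μ ρ d := by
  simp only [expect, mul_add, Finset.sum_add_distrib]

lemma expect_sub (μ : stdSimplex ℝ Ω) (ρ : Ω → stdSimplex ℝ M) (c d : Ω → M → ℝ) :
    expect μ ρ (fun ω m => c ω m - d ω m) = expect μ ρ c - expect μ ρ d := by
  simp only [expect, mul_sub, Finset.sum_sub_distrib]

lemma expect_const_mul (μ : stdSimplex ℝ Ω) (ρ : Ω → stdSimplex ℝ M) (r : ℝ) (c : Ω → M → ℝ) :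
    expect μ ρ (fun ω m => r * c ω m) = r * expect μ ρ c := by
  simp only [expect, Finset.mul_sum]
  exact Finset.sum_congr rfl fun ω _ => Finset.sum_congr rfl fun m _ => by ring

lemma expect_const (μ : stdSimplex ℝ Ω) (ρ : Ω → stdSimplex ℝ M) (r : ℝ) :
    expect μ ρ (fun _ _ => r) = r := by
  simp only [expect, ← Finset.sum_mul, (ρ _).2.2, μ.2.2, one_mul]

lemma expect_message (μ : stdSimplex ℝ Ω) (ρ : Ω → stdSimplex ℝ M) (f : M → ℝ) :
    expect μ ρ (fun _ m => f m) = ∑ m, messageLaw μ ρ m * f m := by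
  simp only [expect, messageLaw, Finset.mul_sum, Finset.sum_mul]
  rw [Finset.sum_comm]
  exact Finset.sum_congr rfl fun ω _ => Finset.sum_congr rfl fun m _ => by ring

lemma messageLaw_nonneg (μ : stdSimplex ℝ Ω) (ρ : Ω → stdSimplex ℝ M) (m : M) :
    0 ≤ messageLaw μ ρ m :=
  Finset.sum_nonneg fun ω _ => mul_nonneg (μ.2.1 ω) ((ρ ω).2.1 m)

lemma sum_messageLaw (μ : stdSimplex ℝ Ω) (ρ : Ω → stdSimplex ℝ M) :
    ∑ m, messageLaw μ ρ m = 1 := by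
  simpa [expect_const] using (expect_message μ ρ (fun _ => 1)).symm

omit [Fintype Ω] [Fintype M] in
lemma abs_meanAction_le {u : Ω → A → ℝ} {B : ℝ} (hB : ∀ ω a, |u ω a| ≤ B)
    (κ : M → stdSimplex ℝ A) (ω : Ω) (m : M) : |meanAction u κ ω m| ≤ B := by
  calc |meanAction u κ ω m| ≤ ∑ a, |(κ m).1 a * u ω a| := Finset.abs_sum_le_sum_abs _ _
    _ ≤ ∑ a, (κ m).1 a * B := Finset.sum_le_sum fun a _ => by
        rw [abs_mul, abs_of_nonneg ((κ m).2.1 a)]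
        exact mul_le_mul_of_nonneg_left (hB ω a) ((κ m).2.1 a)
    _ = B := by rw [← Finset.sum_mul, (κ m).2.2, one_mul]

lemma abs_expect_le {c : Ω → M → ℝ} {B : ℝ} (hB : ∀ ω m, |c ω m| ≤ B) (μ : stdSimplex ℝ Ω)
    (ρ : Ω → stdSimplex ℝ M) : |expect μ ρ c| ≤ B := by
  rw [abs_le]
  constructor
  · rw [← expect_const μ ρ (-B)]
    exact expect_mono μ ρ fun ω m => (abs_le.1 (hB ω m)).1
  · conv_rhs => rw [← expect_const μ ρ B]
    exact expect_mono μ ρ fun ω m => (abs_le.1 (hB ω m)).2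

lemma abs_rulePayoff_le {u : Ω → A → ℝ} {B : ℝ} (hB : ∀ ω a, |u ω a| ≤ B) (μ : stdSimplex ℝ Ω)
    (ρ : Ω → stdSimplex ℝ M) (κ : M → stdSimplex ℝ A) : |rulePayoff μ u ρ κ| ≤ B :=
  abs_expect_le (abs_meanAction_le hB κ) μ ρ

/-- Every Bayes-plausible collection of posteriors comes from a messaging rule. -/
lemma exists_rule_of_bayesPlausible {μ : stdSimplex ℝ Ω} {lam : stdSimplex ℝ M}
    {p : M → stdSimplex ℝ Ω} (h : BayesPlausible μ lam p) :
    ∃ ρ : Ω → stdSimplex ℝ M, ∀ ω m, μ.1 ω * (ρ ω).1 m = lam.1 m * (p m).1 ω := by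
  have hnn : ∀ ω m, 0 ≤ lam.1 m * (p m).1 ω := fun ω m => mul_nonneg (lam.2.1 m) ((p m).2.1 ω)
  have : ∀ ω, ∃ r : stdSimplex ℝ M, ∀ m, μ.1 ω * r.1 m = lam.1 m * (p m).1 ω := by
    intro ω
    by_cases h0 : μ.1 ω = 0
    -- In a state of probability zero the rule is arbitrary; `lam` is merely an available element of
    -- the simplex.
    · refine ⟨lam, fun m => ?_⟩
      have := h ω
      rw [h0, Finset.sum_eq_zero_iff_of_nonneg fun m _ => hnn ω m] at this
      rw [h0, zero_mul, this m (Finset.mem_univ m)]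
    · refine ⟨⟨fun m => lam.1 m * (p m).1 ω / μ.1 ω,
        fun m => div_nonneg (hnn ω m) (μ.2.1 ω), ?_⟩, fun m => mul_div_cancel₀ _ h0⟩
      rw [← Finset.sum_div, h ω, div_self h0]
  choose ρ hρ using this
  exact ⟨ρ, hρ⟩

/-- Every messaging rule comes from a Bayes-plausible collection of posteriors. -/
lemma exists_posterior_of_rule (μ : stdSimplex ℝ Ω) (lam : stdSimplex ℝ M)
    (ρ : Ω → stdSimplex ℝ M) (h : messageLaw μ ρ = lam.1) :
    ∃ p : M → stdSimplex ℝ Ω, ∀ ω m, μ.1 ω * (ρ ω).1 m = lam.1 m * (p m).1 ω := by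
  have hnn : ∀ ω m, 0 ≤ μ.1 ω * (ρ ω).1 m := fun ω m => mul_nonneg (μ.2.1 ω) ((ρ ω).2.1 m)
  have : ∀ m, ∃ r : stdSimplex ℝ Ω, ∀ ω, μ.1 ω * (ρ ω).1 m = lam.1 m * r.1 ω := by
    intro m
    have hm : ∑ ω, μ.1 ω * (ρ ω).1 m = lam.1 m := congrFun h m
    by_cases h0 : lam.1 m = 0
    · refine ⟨μ, fun ω => ?_⟩
      rw [h0, Finset.sum_eq_zero_iff_of_nonneg fun ω _ => hnn ω m] at hm
      rw [h0, zero_mul, hm ω (Finset.mem_univ ω)]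
    · refine ⟨⟨fun ω => μ.1 ω * (ρ ω).1 m / lam.1 m,
        fun ω => div_nonneg (hnn ω m) (lam.2.1 m), ?_⟩, fun ω => (mul_div_cancel₀ _ h0).symm⟩
      rw [← Finset.sum_div, hm, div_self h0]
  choose p hp using this
  exact ⟨p, fun ω m => hp m ω⟩

section Compatible

variable {μ : stdSimplex ℝ Ω} {lam : stdSimplex ℝ M} {p : M → stdSimplex ℝ Ω}
  {ρ : Ω → stdSimplex ℝ M}

lemma bayesPlausible_of_compatible
    (h : ∀ ω m, μ.1 ω * (ρ ω).1 m = lam.1 m * (p m).1 ω) : BayesPlausible μ lam p := fun ω => by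
  simp only [← h, ← Finset.mul_sum, (ρ ω).2.2, mul_one]

lemma messageLaw_of_compatible
    (h : ∀ ω m, μ.1 ω * (ρ ω).1 m = lam.1 m * (p m).1 ω) : messageLaw μ ρ = lam.1 := by
  ext m
  simp only [messageLaw, h, ← Finset.mul_sum, (p m).2.2, mul_one]

lemma expect_of_compatible
    (h : ∀ ω m, μ.1 ω * (ρ ω).1 m = lam.1 m * (p m).1 ω) (c : Ω → M → ℝ) :
    expect μ ρ c = ∑ m, lam.1 m * ∑ ω, (p m).1 ω * c ω m := by
  simp only [expect, Finset.mul_sum, ← mul_assoc, h]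
  exact Finset.sum_comm

lemma rulePayoff_of_compatible
    (h : ∀ ω m, μ.1 ω * (ρ ω).1 m = lam.1 m * (p m).1 ω) (u : Ω → A → ℝ)
    (κ : M → stdSimplex ℝ A) : rulePayoff μ u ρ κ = staticPayoff u lam p κ :=
  expect_of_compatible h _

end Compatible

omit [Fintype M] in
lemma sum_mul_meanAction (u : Ω → A → ℝ) (p : stdSimplex ℝ Ω) (κ : M → stdSimplex ℝ A) (m : M) :
    ∑ ω, p.1 ω * meanAction u κ ω m = ∑ a, (κ m).1 a * ∑ ω, p.1 ω * u ω a := by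
  simp only [meanAction, Finset.mul_sum]
  rw [Finset.sum_comm]
  exact Finset.sum_congr rfl fun a _ => Finset.sum_congr rfl fun ω _ => by ring

lemma senderOptimal_iff {uS : Ω → A → ℝ} {μ : stdSimplex ℝ Ω} {lam : stdSimplex ℝ M}
    {p : M → stdSimplex ℝ Ω} {κ : M → stdSimplex ℝ A} :
    SenderOptimal uS μ lam p κ ↔
      ∀ q, BayesPlausible μ lam q → staticPayoff uS lam q κ ≤ staticPayoff uS lam p κ := by
  simp only [SenderOptimal, staticPayoff, sub_mul, Finset.sum_sub_distrib, mul_sub, sub_nonneg]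

/-- The receiver's payoff is a sum over messages of terms that he controls separately, so global
optimality amounts to optimality after each message of positive probability. -/
lemma receiverOptimal_iff {μ : stdSimplex ℝ Ω} {uR : Ω → A → ℝ} {lam : stdSimplex ℝ M}
    {p : M → stdSimplex ℝ Ω} {ρ : Ω → stdSimplex ℝ M}
    (h : ∀ ω m, μ.1 ω * (ρ ω).1 m = lam.1 m * (p m).1 ω) {κ : M → stdSimplex ℝ A} :
    ReceiverOptimal uR lam p κ ↔ ∀ κ', rulePayoff μ uR ρ κ' ≤ rulePayoff μ uR ρ κ := by
  classical
  simp only [rulePayoff, expect_of_compatible h, sum_mul_meanAction]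
  constructor
  · intro hκ κ'
    refine Finset.sum_le_sum fun m _ => ?_
    rcases (lam.2.1 m).eq_or_lt with h0 | h0
    · rw [← h0, zero_mul, zero_mul]
    refine mul_le_mul_of_nonneg_left ?_ h0.le
    obtain ⟨a₀, ha₀⟩ : ∃ a, (κ m).1 a ≠ 0 := by
      by_contra! hc
      simpa [hc] using (κ m).2.2
    have hbest := hκ m h0
    calc ∑ a, (κ' m).1 a * ∑ ω, (p m).1 ω * uR ω a
        ≤ ∑ a, (κ' m).1 a * ∑ ω, (p m).1 ω * uR ω a₀ := Finset.sum_le_sum fun a _ =>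
          mul_le_mul_of_nonneg_left (hbest ha₀ a) ((κ' m).2.1 a)
      _ = ∑ a, (κ m).1 a * ∑ ω, (p m).1 ω * uR ω a₀ := by
          rw [← Finset.sum_mul, ← Finset.sum_mul, (κ' m).2.2, (κ m).2.2]
      _ ≤ _ := Finset.sum_le_sum fun a _ => by
          by_cases ha : (κ m).1 a = 0
          · rw [ha, zero_mul, zero_mul]
          · exact mul_le_mul_of_nonneg_left (hbest ha a₀) ((κ m).2.1 a)
  · intro hκ m h0 a ha b
    set V : A → ℝ := fun a => ∑ ω, (p m).1 ω * uR ω a with hV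
    set v : ℝ := ∑ a, (κ m).1 a * V a with hv
    have hle : ∀ b, V b ≤ v := by
      intro b
      -- Deviate to the pure action `b` after `m` only; the terms of the other messages cancel.
      have := hκ (Function.update κ m ⟨Pi.single b 1, single_mem_stdSimplex ℝ b⟩)
      rw [← Finset.add_sum_erase _ _ (Finset.mem_univ m),
        ← Finset.add_sum_erase _ _ (Finset.mem_univ m),
        Finset.sum_congr rfl (g := fun m => lam.1 m * ∑ a, (κ m).1 a * ∑ ω, (p m).1 ω * uR ω a)
          fun m' hm' => by rw [Function.update_of_ne (Finset.ne_of_mem_erase hm')]] at this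
      have h2 := le_of_mul_le_mul_left (le_of_add_le_add_right this) h0
      simpa [Pi.single_apply] using h2
    have hzero : ∑ a, (κ m).1 a * (v - V a) = 0 := by
      simp only [mul_sub, Finset.sum_sub_distrib]
      rw [← Finset.sum_mul, (κ m).2.2, one_mul, hv, sub_self]
    rw [Finset.sum_eq_zero_iff_of_nonneg fun a _ =>
      mul_nonneg ((κ m).2.1 a) (sub_nonneg.2 (hle a))] at hzero
    have h3 := (mul_eq_zero.1 (hzero a (Finset.mem_univ a))).resolve_left ha
    have h4 : V a = v := by linarith
    exact (hle b).trans_eq h4.symm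

/-- Equilibrium payoffs of the partial commitment model in terms of messaging rules. -/
lemma iUnion_equilibriumPayoffs (μ : stdSimplex ℝ Ω) (uS uR : Ω → A → ℝ) :
    ⋃ lam : stdSimplex ℝ M, equilibriumPayoffs uS uR μ lam =
      {e | ∃ (ρ : Ω → stdSimplex ℝ M) (κ : M → stdSimplex ℝ A), IsRuleEquilibrium μ uS uR ρ κ ∧
        e = (rulePayoff μ uS ρ κ, rulePayoff μ uR ρ κ)} := by
  ext e
  simp only [Set.mem_iUnion, equilibriumPayoffs, Set.mem_ofPred_eq]
  constructor
  · rintro ⟨lam, p, κ, hp, hR, hS, rfl⟩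
    obtain ⟨ρ, hρ⟩ := exists_rule_of_bayesPlausible hp
    refine ⟨ρ, κ, ⟨fun ρ' hρ' => ?_, (receiverOptimal_iff hρ).1 hR⟩, ?_⟩
    · rw [messageLaw_of_compatible hρ] at hρ'
      obtain ⟨q, hq⟩ := exists_posterior_of_rule μ lam ρ' hρ'
      rw [rulePayoff_of_compatible hq, rulePayoff_of_compatible hρ]
      exact senderOptimal_iff.1 hS q (bayesPlausible_of_compatible hq)
    · rw [rulePayoff_of_compatible hρ, rulePayoff_of_compatible hρ]
  · rintro ⟨ρ, κ, ⟨hS, hR⟩, rfl⟩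
    obtain ⟨p, hp⟩ := exists_posterior_of_rule μ
      ⟨messageLaw μ ρ, messageLaw_nonneg μ ρ, sum_messageLaw μ ρ⟩ ρ rfl
    refine ⟨_, p, κ, bayesPlausible_of_compatible hp, (receiverOptimal_iff hp).2 hR,
      senderOptimal_iff.2 fun q hq => ?_, ?_⟩
    · obtain ⟨ρ', hρ'⟩ := exists_rule_of_bayesPlausible hq
      rw [← rulePayoff_of_compatible hρ', ← rulePayoff_of_compatible hp]
      exact hS ρ' (messageLaw_of_compatible hρ')
    · rw [rulePayoff_of_compatible hp, rulePayoff_of_compatible hp]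

/-! ### Compactness and uniform gains -/

/-- Some deviation that keeps the law of the message, or some deviation of the receiver, gains at
least `ε`. -/
def HasGain (μ : stdSimplex ℝ Ω) (uS uR : Ω → A → ℝ) (ε : ℝ)
    (x : (Ω → stdSimplex ℝ M) × (M → stdSimplex ℝ A)) : Prop :=
  (∃ ρ', messageLaw μ ρ' = messageLaw μ x.1 ∧
    rulePayoff μ uS x.1 x.2 + ε ≤ rulePayoff μ uS ρ' x.2) ∨
  ∃ κ', rulePayoff μ uR x.1 x.2 + ε ≤ rulePayoff μ uR x.1 κ'

@[fun_prop]
lemma continuous_stdSimplex_apply {X ι : Type*} [TopologicalSpace X] [Fintype ι]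
    {f : X → stdSimplex ℝ ι} (hf : Continuous f) (i : ι) : Continuous fun x => (f x).1 i :=
  (continuous_apply i).comp (continuous_subtype_val.comp hf)

lemma continuous_rulePayoff (μ : stdSimplex ℝ Ω) (u : Ω → A → ℝ) :
    Continuous fun x : (Ω → stdSimplex ℝ M) × (M → stdSimplex ℝ A) =>
      rulePayoff μ u x.1 x.2 := by
  unfold rulePayoff expect meanAction
  fun_prop

lemma continuous_messageLaw (μ : stdSimplex ℝ Ω) :
    Continuous fun ρ : Ω → stdSimplex ℝ M => messageLaw μ ρ := by
  unfold messageLaw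
  fun_prop

/-- Profitable deviations persist, with a uniform gain, near a profile that is not an
equilibrium. -/
lemma exists_eventually_hasGain {μ : stdSimplex ℝ Ω} {uS uR : Ω → A → ℝ}
    {x : (Ω → stdSimplex ℝ M) × (M → stdSimplex ℝ A)}
    (hx : ¬ IsRuleEquilibrium μ uS uR x.1 x.2) :
    ∃ ε > 0, ∀ᶠ y in 𝓝 x, HasGain μ uS uR ε y := by
  rw [IsRuleEquilibrium, not_and_or] at hx
  push Not at hx
  rcases hx with ⟨ρ', hlaw, hlt⟩ | ⟨κ', hlt⟩
  -- The same displacement `d` is added to every nearby rule; it leaves the message law unchanged.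
  -- Going only halfway to `ρ'` keeps `x.1 + d` strictly positive wherever `d` is negative, so
  -- nonnegativity survives perturbation.
  · set d : Ω → M → ℝ := fun ω m => ((ρ' ω).1 m - (x.1 ω).1 m) / 2 with hd
    have hdsum : ∀ ω, ∑ m, d ω m = 0 := fun ω => by
      simp only [hd, ← Finset.sum_div, Finset.sum_sub_distrib, (ρ' ω).2.2, (x.1 ω).2.2]
      norm_num
    have hdlaw : ∀ m, ∑ ω, μ.1 ω * d ω m = 0 := fun m => by
      have := congrFun hlaw m
      simp only [messageLaw] at this
      simp only [hd, mul_div_assoc', ← Finset.sum_div, mul_sub, Finset.sum_sub_distrib, this]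
      norm_num
    let G : (M → stdSimplex ℝ A) → ℝ := fun κ => ∑ ω, μ.1 ω * ∑ m, d ω m * meanAction uS κ ω m
    have hGcont : Continuous fun y : (Ω → stdSimplex ℝ M) × (M → stdSimplex ℝ A) => G y.2 := by
      simp only [G]
      unfold meanAction
      fun_prop
    have hGx : 0 < G x.2 := by
      have : G x.2 = (rulePayoff μ uS ρ' x.2 - rulePayoff μ uS x.1 x.2) / 2 := by
        simp only [G, rulePayoff, expect, hd, ← Finset.sum_sub_distrib, ← mul_sub, ← sub_mul,
          Finset.sum_div]
        refine Finset.sum_congr rfl fun ω _ => ?_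
        rw [mul_div_assoc, Finset.sum_div]
        congr 1
        exact Finset.sum_congr rfl fun m _ => by ring
      rw [this]
      linarith
    refine ⟨G x.2 / 2, half_pos hGx, ?_⟩
    have h1 : ∀ᶠ y in 𝓝 x, G x.2 / 2 < G y.2 :=
      hGcont.continuousAt.eventually_const_lt (half_lt_self hGx)
    have h2 : ∀ᶠ y in 𝓝 x, ∀ ω m, 0 ≤ (y.1 ω).1 m + d ω m := by
      rw [eventually_all]
      intro ω
      rw [eventually_all]
      intro m
      rcases le_or_gt 0 (d ω m) with h0 | h0
      · exact Eventually.of_forall fun y => add_nonneg ((y.1 ω).2.1 m) h0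
      · have hc : Continuous fun y : (Ω → stdSimplex ℝ M) × (M → stdSimplex ℝ A) =>
          (y.1 ω).1 m + d ω m := by fun_prop
        have hpos : 0 < (x.1 ω).1 m + d ω m := by
          have := (ρ' ω).2.1 m
          simp only [hd] at h0 ⊢
          linarith
        exact (hc.continuousAt.eventually_const_lt hpos).mono fun y hy => hy.le
    filter_upwards [h1, h2] with y hy1 hy2
    refine Or.inl ⟨fun ω => ⟨fun m => (y.1 ω).1 m + d ω m, hy2 ω, ?_⟩, ?_, ?_⟩
    · rw [Finset.sum_add_distrib, hdsum, (y.1 ω).2.2, add_zero]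
    · ext m
      simp only [messageLaw, mul_add, Finset.sum_add_distrib, hdlaw, add_zero]
    · have : expect μ (fun ω => ⟨fun m => (y.1 ω).1 m + d ω m, hy2 ω, by
          rw [Finset.sum_add_distrib, hdsum, (y.1 ω).2.2, add_zero]⟩) (meanAction uS y.2) =
          expect μ y.1 (meanAction uS y.2) + G y.2 := by
        simp only [expect, G, add_mul, mul_add, Finset.sum_add_distrib]
      rw [rulePayoff, rulePayoff, this]
      linarith
  · set g := rulePayoff μ uR x.1 κ' - rulePayoff μ uR x.1 x.2 with hg
    have hg0 : 0 < g := sub_pos.2 hlt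
    have hc : Continuous fun y : (Ω → stdSimplex ℝ M) × (M → stdSimplex ℝ A) =>
        rulePayoff μ uR y.1 κ' - rulePayoff μ uR y.1 y.2 :=
      ((continuous_rulePayoff μ uR).comp (continuous_fst.prodMk continuous_const)).sub
        (continuous_rulePayoff μ uR)
    refine ⟨g / 2, half_pos hg0, ?_⟩
    filter_upwards [hc.continuousAt.eventually_const_lt (half_lt_self hg0)] with y hy
    exact Or.inr ⟨κ', by linarith⟩

lemma not_isRuleEquilibrium_of_hasGain {μ : stdSimplex ℝ Ω} {uS uR : Ω → A → ℝ} {ε : ℝ}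
    (hε : 0 < ε) {x : (Ω → stdSimplex ℝ M) × (M → stdSimplex ℝ A)} (h : HasGain μ uS uR ε x) :
    ¬ IsRuleEquilibrium μ uS uR x.1 x.2 := by
  rintro ⟨hS, hR⟩
  rcases h with ⟨ρ', hlaw, h⟩ | ⟨κ', h⟩
  · linarith [hS ρ' hlaw]
  · linarith [hR κ']

lemma isCompact_ruleEquilibrium (μ : stdSimplex ℝ Ω) (uS uR : Ω → A → ℝ) :
    IsCompact {x : (Ω → stdSimplex ℝ M) × (M → stdSimplex ℝ A) |
      IsRuleEquilibrium μ uS uR x.1 x.2} := by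
  refine IsClosed.isCompact ?_
  rw [← isOpen_compl_iff, isOpen_iff_eventually]
  intro x hx
  obtain ⟨ε, hε, h⟩ := exists_eventually_hasGain hx
  exact h.mono fun y hy => not_isRuleEquilibrium_of_hasGain hε hy

lemma isCompact_iUnion_equilibriumPayoffs (μ : stdSimplex ℝ Ω) (uS uR : Ω → A → ℝ) :
    IsCompact (⋃ lam : stdSimplex ℝ M, equilibriumPayoffs uS uR μ lam) := by
  rw [iUnion_equilibriumPayoffs]
  convert (isCompact_ruleEquilibrium (M := M) μ uS uR).image
    ((continuous_rulePayoff μ uS).prodMk (continuous_rulePayoff μ uR)) using 1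
  ext e
  simp [eq_comm]

/-- A bound on a continuous function at equilibria extends to all profiles, up to a multiple of
the gains from deviations. -/
lemma exists_gain_bound (μ : stdSimplex ℝ Ω) (uS uR : Ω → A → ℝ)
    {F : (Ω → stdSimplex ℝ M) × (M → stdSimplex ℝ A) → ℝ} (hF : Continuous F) {c c' : ℝ}
    (hc : c < c') (h : ∀ x, IsRuleEquilibrium μ uS uR x.1 x.2 → F x ≤ c) :
    ∃ K : ℝ, 0 ≤ K ∧ ∀ x : (Ω → stdSimplex ℝ M) × (M → stdSimplex ℝ A),
      ∃ (ρ' : Ω → stdSimplex ℝ M) (κ' : M → stdSimplex ℝ A),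
      messageLaw μ ρ' = messageLaw μ x.1 ∧
      F x ≤ c' + K * ((rulePayoff μ uS ρ' x.2 - rulePayoff μ uS x.1 x.2) +
        (rulePayoff μ uR x.1 κ' - rulePayoff μ uR x.1 x.2)) := by
  have hcover : ∃ ε > 0, ∀ x ∈ (Set.univ : Set ((Ω → stdSimplex ℝ M) × (M → stdSimplex ℝ A))),
      F x ≤ c' ∨ HasGain μ uS uR ε x := by
    -- The local gains become one uniform `ε`, because the property of having one passes to subsets
    -- and finite unions.
    refine isCompact_univ.induction_on ⟨1, one_pos, by simp⟩ ?_ ?_ ?_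
    · rintro s t hst ⟨ε, hε, ht⟩
      exact ⟨ε, hε, fun x hx => ht x (hst hx)⟩
    · rintro s t ⟨ε, hε, hs⟩ ⟨ε', hε', ht⟩
      have hmono : ∀ {r r' : ℝ} {x}, r ≤ r' → HasGain μ uS uR r' x →
          HasGain (M := M) μ uS uR r x := by
        rintro r r' x hr (⟨ρ', h1, h2⟩ | ⟨κ', h1⟩)
        · exact Or.inl ⟨ρ', h1, by linarith⟩
        · exact Or.inr ⟨κ', by linarith⟩
      refine ⟨min ε ε', lt_min hε hε', ?_⟩
      rintro x (hx | hx)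
      · exact (hs x hx).imp_right (hmono (min_le_left _ _))
      · exact (ht x hx).imp_right (hmono (min_le_right _ _))
    · intro x _
      by_cases hx : IsRuleEquilibrium μ uS uR x.1 x.2
      · refine ⟨{y | F y < c'}, mem_nhdsWithin_of_mem_nhds ?_, 1, one_pos, fun y hy => Or.inl hy.le⟩
        exact hF.continuousAt.eventually_lt_const ((h x hx).trans_lt hc)
      · obtain ⟨ε, hε, hev⟩ := exists_eventually_hasGain hx
        exact ⟨_, mem_nhdsWithin_of_mem_nhds hev, ε, hε, fun y hy => Or.inr hy⟩
  obtain ⟨ε, hε, hcov⟩ := hcover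
  obtain ⟨B, hB⟩ := isCompact_univ.exists_bound_of_continuousOn hF.continuousOn
  -- A gain of at least `ε` multiplied by this constant covers the largest possible excess of `F`
  -- over `c'`.
  refine ⟨(|B| + |c'|) / ε, by positivity, fun x => ?_⟩
  have hgain : ∀ g, ε ≤ g → F x ≤ c' + (|B| + |c'|) / ε * g := by
    intro g hg
    have h1 : (|B| + |c'|) / ε * ε ≤ (|B| + |c'|) / ε * g :=
      mul_le_mul_of_nonneg_left hg (by positivity)
    rw [div_mul_cancel₀ _ hε.ne'] at h1
    have h2 := (le_abs_self _).trans (hB x trivial)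
    linarith [le_abs_self B, neg_abs_le c']
  rcases hcov x trivial with h0 | ⟨ρ', hlaw, hg⟩ | ⟨κ', hg⟩
  · exact ⟨x.1, x.2, rfl, by simpa using h0⟩
  · exact ⟨ρ', x.2, hlaw, hgain _ (by linarith)⟩
  · exact ⟨x.1, κ', rfl, hgain _ (by linarith)⟩

/-! ### Prices of messages -/

/-- Approximate linear programming duality for the sender's problem. -/
lemma exists_price {μ : stdSimplex ℝ Ω} {uS uR : Ω → A → ℝ} {ρ : Ω → stdSimplex ℝ M}
    {κ : M → stdSimplex ℝ A} (h : IsRuleEquilibrium μ uS uR ρ κ) {η : ℝ} (hη : 0 < η) :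
    ∃ ψ : M → ℝ, ∀ ρ' : Ω → stdSimplex ℝ M,
      rulePayoff μ uS ρ' κ - ∑ m, messageLaw μ ρ' m * ψ m ≤
        rulePayoff μ uS ρ κ + η - ∑ m, messageLaw μ ρ m * ψ m := by
  classical
  let C : Set ((M → ℝ) × ℝ) :=
    Set.range fun ρ' : Ω → stdSimplex ℝ M => (messageLaw μ ρ', rulePayoff μ uS ρ' κ)
  have hcomp : IsCompact C := by
    refine isCompact_range ((continuous_messageLaw μ).prodMk ?_)
    exact (continuous_rulePayoff μ uS).comp (continuous_id.prodMk continuous_const)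
  have hconv : Convex ℝ C := by
    rintro _ ⟨ρ₁, rfl⟩ _ ⟨ρ₂, rfl⟩ a b ha hb hab
    refine ⟨fun ω => ⟨a • (ρ₁ ω).1 + b • (ρ₂ ω).1,
      convex_stdSimplex ℝ M (ρ₁ ω).2 (ρ₂ ω).2 ha hb hab⟩, Prod.ext (funext fun m => ?_) ?_⟩
    · simp only [messageLaw, Pi.add_apply, Pi.smul_apply, smul_eq_mul, Prod.fst_add, Prod.smul_fst,
        Finset.mul_sum, ← Finset.sum_add_distrib]
      exact Finset.sum_congr rfl fun ω _ => by ring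
    · simp only [rulePayoff, expect, Pi.add_apply, Pi.smul_apply, smul_eq_mul, Prod.snd_add,
        Prod.smul_snd, Finset.mul_sum, ← Finset.sum_add_distrib]
      exact Finset.sum_congr rfl fun ω _ => Finset.sum_congr rfl fun m _ => by ring
  -- The slack `η` puts the point strictly outside the compact convex set `C`, so strict separation
  -- applies and the payoff coordinate of the functional cannot vanish.
  have hnot : (messageLaw μ ρ, rulePayoff μ uS ρ κ + η) ∉ C := by
    rintro ⟨ρ', h'⟩
    have h1 := h.1 ρ' (congrArg Prod.fst h')
    have h2 : rulePayoff μ uS ρ' κ = rulePayoff μ uS ρ κ + η := congrArg Prod.snd h'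
    linarith
  obtain ⟨f, b, hlt, hb⟩ := geometric_hahn_banach_closed_point hconv hcomp.isClosed hnot
  have hf : ∀ (l : M → ℝ) (r : ℝ), f (l, r) = ∑ m, l m * f (Pi.single m 1, 0) + r * f (0, 1) := by
    intro l r
    have hl : (l, r) = ∑ m, l m • ((Pi.single m 1, 0) : (M → ℝ) × ℝ) +
        r • ((0, 1) : (M → ℝ) × ℝ) := by
      refine Prod.ext (funext fun m' => ?_) ?_
      · simp [Prod.fst_sum, Finset.sum_apply, Pi.single_apply]
      · simp [Prod.snd_sum]
    conv_lhs => rw [hl]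
    simp only [map_add, map_sum, map_smul, smul_eq_mul]
  set t := f (0, 1) with ht
  have hall : ∀ ρ' : Ω → stdSimplex ℝ M,
      ∑ m, messageLaw μ ρ' m * f (Pi.single m 1, 0) + rulePayoff μ uS ρ' κ * t <
      ∑ m, messageLaw μ ρ m * f (Pi.single m 1, 0) + (rulePayoff μ uS ρ κ + η) * t := by
    intro ρ'
    have := (hlt _ ⟨ρ', rfl⟩).trans hb
    rwa [hf, hf] at this
  have ht0 : 0 < t := by
    -- Tested at `ρ` itself, the separation reads `0 < η * t`.
    have := hall ρ
    nlinarith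
  refine ⟨fun m => -f (Pi.single m 1, 0) / t, fun ρ' => ?_⟩
  have h1 := hall ρ'
  simp only [mul_div_assoc', mul_neg, ← Finset.sum_div, Finset.sum_neg_distrib]
  rw [neg_div, neg_div, sub_neg_eq_add, sub_neg_eq_add, ← sub_nonneg]
  have h2 : rulePayoff μ uS ρ κ + η + (∑ m, messageLaw μ ρ m * f (Pi.single m 1, 0)) / t -
      (rulePayoff μ uS ρ' κ + (∑ m, messageLaw μ ρ' m * f (Pi.single m 1, 0)) / t) =
      (∑ m, messageLaw μ ρ m * f (Pi.single m 1, 0) + (rulePayoff μ uS ρ κ + η) * t -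
      (∑ m, messageLaw μ ρ' m * f (Pi.single m 1, 0) + rulePayoff μ uS ρ' κ * t)) / t := by
    field_simp
    ring
  rw [h2]
  exact div_nonneg (sub_nonneg.2 h1.le) ht0.le

end Static

/-! ### Compactness of convex hulls -/

section Hull

/-- The convex hull of a compact set in a finite-dimensional space is compact. -/
lemma isCompact_convexHull_of_finiteDimensional {E : Type*} [NormedAddCommGroup E]
    [NormedSpace ℝ E] [FiniteDimensional ℝ E] {s : Set E} (hs : IsCompact s) :
    IsCompact (convexHull ℝ s) := by
  classical
  -- `C k` collects the convex combinations of at most `k + 1` points of `s`; by Carathéodory,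
  -- taking `k` to be the dimension exhausts the hull.
  let C : ℕ → Set E := fun k => Nat.rec s (fun _ t => convexJoin ℝ s t) k
  have hCs : ∀ k, C (k + 1) = convexJoin ℝ s (C k) := fun k => rfl
  have hjoin : ∀ {t : Set E}, IsCompact t → IsCompact (convexJoin ℝ s t) := by
    intro t ht
    have : convexJoin ℝ s t = (fun x : ℝ × E × E => (1 - x.1) • x.2.1 + x.1 • x.2.2) ''
        (Set.Icc (0 : ℝ) 1 ×ˢ s ×ˢ t) := by
      ext z
      simp only [mem_convexJoin, segment_eq_image, Set.mem_image, Set.mem_prod, Prod.exists]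
      constructor
      · rintro ⟨x, hx, y, hy, r, hr, rfl⟩
        exact ⟨r, x, y, ⟨hr, hx, hy⟩, rfl⟩
      · rintro ⟨r, x, y, ⟨hr, hx, hy⟩, rfl⟩
        exact ⟨x, hx, y, hy, r, hr, rfl⟩
    rw [this]
    exact (isCompact_Icc.prod (hs.prod ht)).image (by fun_prop)
  have hC : ∀ k, IsCompact (C k) := by
    intro k
    induction k with
    | zero => exact hs
    | succ k ih => rw [hCs]; exact hjoin ih
  have hsub : ∀ k, C k ⊆ convexHull ℝ s := by
    intro k
    induction k with
    | zero => exact subset_convexHull ℝ s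
    | succ k ih =>
      rw [hCs]
      exact convexJoin_subset (subset_convexHull ℝ s) ih (convex_convexHull ℝ s)
  have hfin : ∀ k (t : Finset E), ↑t ⊆ s → t.card ≤ k + 1 → convexHull ℝ (t : Set E) ⊆ C k := by
    intro k
    induction k with
    | zero =>
      intro t ht hcard
      rcases Finset.card_le_one_iff_subset_singleton.1 hcard with ⟨x, hx⟩
      rcases Finset.subset_singleton_iff.1 hx with rfl | rfl
      · simp
      · simpa [C] using ht
    | succ k ih =>
      intro t ht hcard
      rcases t.eq_empty_or_nonempty with rfl | ⟨x, hx⟩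
      · simp
      rcases (t.erase x).eq_empty_or_nonempty with h0 | h0
      · have htx : t = {x} := by
          rw [← Finset.insert_erase hx, h0]
          rfl
        have hxs : x ∈ s := ht hx
        have : x ∈ C k := ih {x} (by simpa using hxs) (by simp) (by simp)
        rw [htx, hCs]
        simp only [Finset.coe_singleton, convexHull_singleton, Set.singleton_subset_iff]
        exact mem_convexJoin.2 ⟨x, hxs, x, this, left_mem_segment ℝ x x⟩
      · rw [← Finset.insert_erase hx, Finset.coe_insert, convexHull_insert (by exact_mod_cast h0),
          hCs]
        refine convexJoin_mono (Set.singleton_subset_iff.2 (ht hx)) (ih _ ?_ ?_)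
        · exact fun y hy => ht (Finset.mem_of_mem_erase hy)
        · rw [Finset.card_erase_of_mem hx]
          omega
  have : convexHull ℝ s = C (Module.finrank ℝ E) := by
    refine Set.Subset.antisymm ?_ (hsub _)
    rw [convexHull_eq_union]
    refine Set.iUnion_subset fun t => Set.iUnion_subset fun hts => Set.iUnion_subset fun hind => ?_
    refine hfin _ t hts ?_
    have := hind.card_le_finrank_succ
    rw [Fintype.card_coe] at this
    exact this.trans (Nat.succ_le_succ (Submodule.finrank_le _))
  rw [this]
  exact hC _

end Hull

/-! ### Reduction to strategies depending on messages only -/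

section Reduction

/-- Summation over tuples, one coordinate at a time. -/
lemma sum_snoc {α : Type*} [Fintype α] {n : ℕ} (F : (Fin (n + 1) → α) → ℝ) :
    ∑ v, F v = ∑ v : Fin n → α, ∑ x : α, F (Fin.snoc (α := fun _ => α) v x) := by
  rw [← (Fin.snocEquiv fun _ : Fin (n + 1) => α).sum_comp, Fintype.sum_prod_type,
    Finset.sum_comm]
  rfl

variable {Ω M A : Type*} [Fintype Ω] [Fintype M] [Fintype A]

/-- The contribution of nature and of the sender to the probability of a history. -/
def senderProb (μ : stdSimplex ℝ Ω) (σ : SenderStrategy Ω M) :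
    (n : ℕ) → (Fin n → Ω) → (Fin n → M) → ℝ
  | 0, _, _ => 1
  | n + 1, v, w => senderProb μ σ n (fun k => v k.castSucc) (fun k => w k.castSucc) *
      μ.1 (v (Fin.last n)) *
      (σ n (fun k => (v k.castSucc, w k.castSucc)) (v (Fin.last n))).1 (w (Fin.last n))

/-- The contribution of the receiver to the probability of a history. -/
def receiverProb (τ : ReceiverStrategy M A) : (n : ℕ) → (Fin n → M) → (Fin n → A) → ℝ
  | 0, _, _ => 1
  | n + 1, w, b => receiverProb τ n (fun k => w k.castSucc) (fun k => b k.castSucc) *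
      (τ n (fun k => (w k.castSucc, b k.castSucc)) (w (Fin.last n))).1 (b (Fin.last n))

lemma stateLaw_of_iid {μ : stdSimplex ℝ Ω} {Q : Ω → stdSimplex ℝ Ω} (hQ : ∀ ω, Q ω = μ) (n : ℕ)
    (past : Fin n → Ω) : stateLaw μ Q n past = μ := by
  cases n with
  | zero => rfl
  | succ n => exact hQ _

/-- The sender never sees actions and the receiver never sees states, so the probability factors;
this is the conditional independence given the messages. -/
lemma historyProb_eq {μ : stdSimplex ℝ Ω} {Q : Ω → stdSimplex ℝ Ω} (hQ : ∀ ω, Q ω = μ)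
    (σ : SenderStrategy Ω M) (τ : ReceiverStrategy M A) (n : ℕ) (h : Fin n → Ω × M × A) :
    historyProb μ Q σ τ n h = senderProb μ σ n (fun k => (h k).1) (fun k => (h k).2.1) *
      receiverProb τ n (fun k => (h k).2.1) (fun k => (h k).2.2) := by
  induction n with
  | zero => simp [historyProb, senderProb, receiverProb]
  | succ n ih =>
    simp only [historyProb, senderProb, receiverProb, ih, stateLaw_of_iid hQ]
    ring

lemma senderProb_nonneg (μ : stdSimplex ℝ Ω) (σ : SenderStrategy Ω M) (n : ℕ) (v : Fin n → Ω)
    (w : Fin n → M) : 0 ≤ senderProb μ σ n v w := by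
  induction n with
  | zero => exact zero_le_one
  | succ n ih =>
    exact mul_nonneg (mul_nonneg (ih _ _) (μ.2.1 _)) ((σ n _ _).2.1 _)

omit [Fintype M] in
lemma receiverProb_nonneg (τ : ReceiverStrategy M A) (n : ℕ) (w : Fin n → M) (b : Fin n → A) :
    0 ≤ receiverProb τ n w b := by
  induction n with
  | zero => exact zero_le_one
  | succ n ih => exact mul_nonneg (ih _ _) ((τ n _ _).2.1 _)

omit [Fintype M] in
lemma sum_receiverProb (τ : ReceiverStrategy M A) (n : ℕ) (w : Fin n → M) :
    ∑ b, receiverProb τ n w b = 1 := by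
  induction n with
  | zero => simp [receiverProb]
  | succ n ih =>
    rw [sum_snoc]
    simp only [receiverProb, Fin.snoc_castSucc, Fin.snoc_last, ← Finset.mul_sum, (τ n _ _).2.2,
      mul_one, ih]

/-- The probability that the past messages are `w` and that the next one is `m` in state `ω`. -/
def sentWeight (μ : stdSimplex ℝ Ω) (σ : SenderStrategy Ω M) (n : ℕ) (w : Fin n → M) (ω : Ω)
    (m : M) : ℝ :=
  ∑ v : Fin n → Ω, senderProb μ σ n v w * (σ n (fun k => (v k, w k)) ω).1 m

/-- The probability that the first messages are `w`. -/
def messageWeight (μ : stdSimplex ℝ Ω) (σ : SenderStrategy Ω M) (n : ℕ) (w : Fin n → M) : ℝ :=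
  ∑ v : Fin n → Ω, senderProb μ σ n v w

/-- The law of the action given the past and current messages. -/
def receiverKernel (τ : ReceiverStrategy M A) (n : ℕ) (w : Fin n → M) (m : M) :
    stdSimplex ℝ A :=
  ⟨fun a => ∑ b : Fin n → A, receiverProb τ n w b * (τ n (fun k => (w k, b k)) m).1 a,
    fun a => Finset.sum_nonneg fun b _ =>
      mul_nonneg (receiverProb_nonneg τ n w b) ((τ n _ m).2.1 a), by
    rw [Finset.sum_comm]
    simp only [← Finset.mul_sum, (τ n _ m).2.2, mul_one, sum_receiverProb]⟩

lemma stagePayoff_eq {μ : stdSimplex ℝ Ω} {Q : Ω → stdSimplex ℝ Ω} (hQ : ∀ ω, Q ω = μ)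
    (u : Ω → A → ℝ) (σ : SenderStrategy Ω M) (τ : ReceiverStrategy M A) (n : ℕ) :
    stagePayoff u μ Q σ τ n = ∑ w : Fin n → M, ∑ ω, μ.1 ω * ∑ m, sentWeight μ σ n w ω m *
      meanAction u (receiverKernel τ n w) ω m := by
  let e : (Fin n → Ω × M × A) ≃ (Fin n → M) × (Fin n → Ω) × (Fin n → A) :=
    { toFun := fun h => (fun k => (h k).2.1, fun k => (h k).1, fun k => (h k).2.2)
      invFun := fun p k => (p.2.1 k, p.1 k, p.2.2 k)
      left_inv := fun h => rfl
      right_inv := fun p => rfl }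
  have hR : ∀ w : Fin n → M, ∑ ω, μ.1 ω * ∑ m, sentWeight μ σ n w ω m *
      meanAction u (receiverKernel τ n w) ω m = ∑ x : Ω × M × A,
        μ.1 x.1 * (sentWeight μ σ n w x.1 x.2.1 * ((receiverKernel τ n w x.2.1).1 x.2.2 *
          u x.1 x.2.2)) := fun w => by
    simp only [meanAction, Finset.mul_sum, Fintype.sum_prod_type]
  simp only [hR]
  rw [stagePayoff, sum_snoc, Finset.sum_comm, Finset.sum_comm (s := (Finset.univ : Finset (Fin n → M)))]
  refine Finset.sum_congr rfl fun x _ => ?_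
  rw [← e.symm.sum_comp, Fintype.sum_prod_type]
  refine Finset.sum_congr rfl fun w _ => ?_
  simp only [historyProb, Fin.snoc_castSucc, Fin.snoc_last, historyProb_eq hQ,
    stateLaw_of_iid hQ, Fintype.sum_prod_type, sentWeight, receiverKernel]
  rw [← mul_assoc, ← mul_assoc, mul_assoc (μ.1 x.1), Finset.sum_mul_sum, Finset.mul_sum,
    Finset.sum_mul]
  refine Finset.sum_congr rfl fun v _ => ?_
  rw [Finset.mul_sum, Finset.sum_mul]
  refine Finset.sum_congr rfl fun b _ => ?_
  simp only [e, Equiv.coe_fn_symm_mk]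
  ring

/-- Strategies of the sender that depend on the past only through the messages. -/
abbrev MessageStrategy (Ω M : Type*) [Fintype M] : Type _ :=
  (n : ℕ) → (Fin n → M) → Ω → stdSimplex ℝ M

/-- Strategies of the receiver that depend on the past only through the messages. -/
abbrev ResponseStrategy (M A : Type*) [Fintype A] : Type _ :=
  (n : ℕ) → (Fin n → M) → M → stdSimplex ℝ A

/-- A message strategy as a strategy of the sender. -/
def MessageStrategy.toSender (ρ : MessageStrategy Ω M) : SenderStrategy Ω M :=
  fun n h ω => ρ n (fun k => (h k).2) ω

/-- A response strategy as a strategy of the receiver. -/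
def ResponseStrategy.toReceiver (κ : ResponseStrategy M A) : ReceiverStrategy M A :=
  fun n h m => κ n (fun k => (h k).1) m

/-- The probability of a sequence of messages under a message strategy. -/
def messageProb (μ : stdSimplex ℝ Ω) (ρ : MessageStrategy Ω M) : (n : ℕ) → (Fin n → M) → ℝ
  | 0, _ => 1
  | n + 1, w => messageProb μ ρ n (fun k => w k.castSucc) *
      messageLaw μ (ρ n (fun k => w k.castSucc)) (w (Fin.last n))

/-- The expectation of a function of the first `n` messages under a message strategy. -/
def messageMean (μ : stdSimplex ℝ Ω) (ρ : MessageStrategy Ω M) (n : ℕ)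
    (F : (Fin n → M) → ℝ) : ℝ :=
  ∑ w, messageProb μ ρ n w * F w

lemma messageProb_nonneg (μ : stdSimplex ℝ Ω) (ρ : MessageStrategy Ω M) (n : ℕ)
    (w : Fin n → M) : 0 ≤ messageProb μ ρ n w := by
  induction n with
  | zero => exact zero_le_one
  | succ n ih => exact mul_nonneg (ih _) (messageLaw_nonneg μ _ _)

lemma messageMean_zero (μ : stdSimplex ℝ Ω) (ρ : MessageStrategy Ω M) (F : (Fin 0 → M) → ℝ) :
    messageMean μ ρ 0 F = F Fin.elim0 := by
  simp only [messageMean, messageProb, one_mul, Fintype.sum_unique]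
  exact congrArg F (Subsingleton.elim _ _)

lemma messageMean_succ (μ : stdSimplex ℝ Ω) (ρ : MessageStrategy Ω M) (n : ℕ)
    (F : (Fin (n + 1) → M) → ℝ) :
    messageMean μ ρ (n + 1) F = messageMean μ ρ n fun w =>
      expect μ (ρ n w) fun _ m => F (Fin.snoc (α := fun _ => M) w m) := by
  simp only [messageMean, sum_snoc, messageProb, Fin.snoc_castSucc, Fin.snoc_last,
    expect_message, Finset.mul_sum, mul_assoc]

lemma messageMean_mono (μ : stdSimplex ℝ Ω) (ρ : MessageStrategy Ω M) (n : ℕ)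
    {F G : (Fin n → M) → ℝ} (h : ∀ w, F w ≤ G w) :
    messageMean μ ρ n F ≤ messageMean μ ρ n G :=
  Finset.sum_le_sum fun w _ => mul_le_mul_of_nonneg_left (h w) (messageProb_nonneg μ ρ n w)

lemma messageMean_add (μ : stdSimplex ℝ Ω) (ρ : MessageStrategy Ω M) (n : ℕ)
    (F G : (Fin n → M) → ℝ) :
    messageMean μ ρ n (fun w => F w + G w) = messageMean μ ρ n F + messageMean μ ρ n G := by
  simp only [messageMean, mul_add, Finset.sum_add_distrib]

lemma messageMean_sub (μ : stdSimplex ℝ Ω) (ρ : MessageStrategy Ω M) (n : ℕ)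
    (F G : (Fin n → M) → ℝ) :
    messageMean μ ρ n (fun w => F w - G w) = messageMean μ ρ n F - messageMean μ ρ n G := by
  simp only [messageMean, mul_sub, Finset.sum_sub_distrib]

lemma messageMean_const_mul (μ : stdSimplex ℝ Ω) (ρ : MessageStrategy Ω M) (n : ℕ) (r : ℝ)
    (F : (Fin n → M) → ℝ) :
    messageMean μ ρ n (fun w => r * F w) = r * messageMean μ ρ n F := by
  simp only [messageMean, Finset.mul_sum]
  exact Finset.sum_congr rfl fun w _ => by ring

lemma messageMean_const (μ : stdSimplex ℝ Ω) (ρ : MessageStrategy Ω M) (n : ℕ) (r : ℝ) :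
    messageMean μ ρ n (fun _ => r) = r := by
  induction n with
  | zero => exact messageMean_zero μ ρ _
  | succ n ih => rw [messageMean_succ]; simpa only [expect_const] using ih

/-- This is why deviations that preserve each conditional message law are undetectable. -/
lemma messageProb_congr {μ : stdSimplex ℝ Ω} {ρ ρ' : MessageStrategy Ω M}
    (h : ∀ n w, messageLaw μ (ρ' n w) = messageLaw μ (ρ n w)) (n : ℕ) (w : Fin n → M) :
    messageProb μ ρ' n w = messageProb μ ρ n w := by
  induction n with
  | zero => rfl
  | succ n ih => simp only [messageProb, ih, h]

lemma sum_sentWeight (μ : stdSimplex ℝ Ω) (σ : SenderStrategy Ω M) (n : ℕ) (w : Fin n → M)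
    (ω : Ω) : ∑ m, sentWeight μ σ n w ω m = messageWeight μ σ n w := by
  simp only [sentWeight, messageWeight]
  rw [Finset.sum_comm]
  simp only [← Finset.mul_sum, (σ n _ ω).2.2, mul_one]

lemma sentWeight_nonneg (μ : stdSimplex ℝ Ω) (σ : SenderStrategy Ω M) (n : ℕ) (w : Fin n → M)
    (ω : Ω) (m : M) : 0 ≤ sentWeight μ σ n w ω m :=
  Finset.sum_nonneg fun v _ => mul_nonneg (senderProb_nonneg μ σ n v w) ((σ n _ ω).2.1 m)

lemma messageWeight_succ (μ : stdSimplex ℝ Ω) (σ : SenderStrategy Ω M) (n : ℕ)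
    (w : Fin (n + 1) → M) :
    messageWeight μ σ (n + 1) w =
      ∑ ω, μ.1 ω * sentWeight μ σ n (fun k => w k.castSucc) ω (w (Fin.last n)) := by
  simp only [messageWeight, sum_snoc, senderProb, sentWeight, Fin.snoc_castSucc, Fin.snoc_last,
    Finset.mul_sum]
  rw [Finset.sum_comm]
  exact Finset.sum_congr rfl fun ω _ => Finset.sum_congr rfl fun v _ => by ring

/-- `ρ` describes the conditional laws of messages given past messages under `σ`. -/
def IsReduction (μ : stdSimplex ℝ Ω) (σ : SenderStrategy Ω M) (ρ : MessageStrategy Ω M) : Prop :=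
  ∀ n w ω m, sentWeight μ σ n w ω m = messageWeight μ σ n w * (ρ n w ω).1 m

/-- Average over the past states by conditioning on the past messages; the rule is arbitrary after
message histories of probability zero. -/
lemma exists_isReduction (μ : stdSimplex ℝ Ω) (σ : SenderStrategy Ω M) :
    ∃ ρ, IsReduction μ σ ρ := by
  have : ∀ n w ω, ∃ r : stdSimplex ℝ M, ∀ m,
      sentWeight μ σ n w ω m = messageWeight μ σ n w * r.1 m := by
    intro n w ω
    have hs := sum_sentWeight μ σ n w ω
    by_cases h0 : messageWeight μ σ n w = 0
    · refine ⟨σ 0 Fin.elim0 ω, fun m => ?_⟩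
      rw [h0, Finset.sum_eq_zero_iff_of_nonneg fun m _ => sentWeight_nonneg μ σ n w ω m] at hs
      rw [hs m (Finset.mem_univ m), h0, zero_mul]
    · refine ⟨⟨fun m => sentWeight μ σ n w ω m / messageWeight μ σ n w, fun m =>
        div_nonneg (sentWeight_nonneg μ σ n w ω m)
          (Finset.sum_nonneg fun v _ => senderProb_nonneg μ σ n v w), ?_⟩,
        fun m => (mul_div_cancel₀ _ h0).symm⟩
      rw [← Finset.sum_div, hs, div_self h0]
  choose ρ hρ using this
  exact ⟨ρ, hρ⟩

lemma isReduction_toSender (μ : stdSimplex ℝ Ω) (ρ : MessageStrategy Ω M) :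
    IsReduction μ ρ.toSender ρ := fun n w ω m => by
  simp only [sentWeight, messageWeight, MessageStrategy.toSender, ← Finset.sum_mul]

lemma IsReduction.messageProb_eq {μ : stdSimplex ℝ Ω} {σ : SenderStrategy Ω M}
    {ρ : MessageStrategy Ω M} (h : IsReduction μ σ ρ) (n : ℕ) (w : Fin n → M) :
    messageProb μ ρ n w = messageWeight μ σ n w := by
  induction n with
  | zero => simp [messageProb, messageWeight, senderProb]
  | succ n ih =>
    rw [messageWeight_succ, messageProb, ih, messageLaw, Finset.mul_sum]
    refine Finset.sum_congr rfl fun ω _ => ?_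
    rw [h]
    ring

/-- Stage payoffs only depend on the conditional laws given past messages. -/
lemma IsReduction.stagePayoff_eq {μ : stdSimplex ℝ Ω} {σ : SenderStrategy Ω M}
    {ρ : MessageStrategy Ω M} (h : IsReduction μ σ ρ) {Q : Ω → stdSimplex ℝ Ω}
    (hQ : ∀ ω, Q ω = μ) (u : Ω → A → ℝ) (τ : ReceiverStrategy M A) (n : ℕ) :
    stagePayoff u μ Q σ τ n = messageMean μ ρ n fun w =>
      rulePayoff μ u (ρ n w) (receiverKernel τ n w) := by
  rw [Persuasion.stagePayoff_eq hQ, messageMean]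
  refine Finset.sum_congr rfl fun w _ => ?_
  simp only [rulePayoff, expect, h.messageProb_eq, h n w, Finset.mul_sum]
  exact Finset.sum_congr rfl fun ω _ => Finset.sum_congr rfl fun m _ => by ring

omit [Fintype M] in
lemma receiverKernel_toReceiver (κ : ResponseStrategy M A) (n : ℕ) (w : Fin n → M) :
    receiverKernel κ.toReceiver n w = κ n w := by
  ext m
  simp only [receiverKernel, ResponseStrategy.toReceiver, ← Finset.sum_mul, sum_receiverProb,
    one_mul]

lemma stagePayoff_toSender_toReceiver {μ : stdSimplex ℝ Ω} {Q : Ω → stdSimplex ℝ Ω}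
    (hQ : ∀ ω, Q ω = μ) (u : Ω → A → ℝ) (ρ : MessageStrategy Ω M) (κ : ResponseStrategy M A)
    (n : ℕ) : stagePayoff u μ Q ρ.toSender κ.toReceiver n = messageMean μ ρ n fun w =>
      rulePayoff μ u (ρ n w) (κ n w) := by
  simp only [(isReduction_toSender μ ρ).stagePayoff_eq hQ, receiverKernel_toReceiver]

end Reduction

/-! ### From partial sums to discounted averages -/

section Discounting

lemma summable_discounted {x : ℕ → ℝ} {B : ℝ} (hB : ∀ n, |x n| ≤ B) {δ : ℝ} (h0 : 0 < δ)
    (h1 : δ < 1) : Summable fun n => δ ^ n * x n := by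
  refine Summable.of_norm_bounded (g := fun n => δ ^ n * B)
    ((summable_geometric_of_lt_one h0.le h1).mul_right B) fun n => ?_
  rw [norm_mul, norm_pow, Real.norm_of_nonneg h0.le]
  exact mul_le_mul_of_nonneg_left (hB n) (pow_nonneg h0.le n)

/-- A linear upper bound on partial sums gives an upper bound on discounted averages. -/
lemma discounted_le_of_sum_le {x : ℕ → ℝ} {B ε K : ℝ} (hB : ∀ n, |x n| ≤ B)
    (hx : ∀ T : ℕ, ∑ t ∈ Finset.range T, x t ≤ ε * T + K) {δ : ℝ} (h0 : 0 < δ) (h1 : δ < 1) :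
    (1 - δ) * ∑' n, δ ^ n * x n ≤ ε + (1 - δ) * K := by
  have hδ : 0 < 1 - δ := sub_pos.2 h1
  have hgeom : ∀ N, (1 - δ) * ∑ t ∈ Finset.range N, δ ^ t = 1 - δ ^ N := fun N => by
    rw [mul_comm, ← neg_inj, ← mul_neg, neg_sub, geom_sum_mul, neg_sub]
  -- Summation by parts: the weights on the partial sums, `(1 - δ) * δ ^ t` and `δ ^ N`, are
  -- nonnegative with total one, so the bound `K` is inherited.
  have habel : ∀ N, ∑ t ∈ Finset.range N, δ ^ t * (x t - ε) =
      (1 - δ) * ∑ t ∈ Finset.range N, δ ^ t * (∑ k ∈ Finset.range (t + 1), (x k - ε)) +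
        δ ^ N * ∑ k ∈ Finset.range N, (x k - ε) := by
    intro N
    induction N with
    | zero => simp
    | succ N ih =>
      rw [Finset.sum_range_succ, ih, Finset.sum_range_succ (n := N), Finset.sum_range_succ _ N]
      ring
  have hS : ∀ T, ∑ k ∈ Finset.range T, (x k - ε) ≤ K := fun T => by
    rw [Finset.sum_sub_distrib, Finset.sum_const, Finset.card_range, nsmul_eq_mul]
    linarith [hx T]
  have hle : ∀ N, ∑ t ∈ Finset.range N, δ ^ t * (x t - ε) ≤ K := by
    intro N
    have h2 : ∑ t ∈ Finset.range N, δ ^ t * (∑ k ∈ Finset.range (t + 1), (x k - ε)) ≤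
        (∑ t ∈ Finset.range N, δ ^ t) * K := by
      rw [Finset.sum_mul]
      exact Finset.sum_le_sum fun t _ => mul_le_mul_of_nonneg_left (hS _) (pow_nonneg h0.le t)
    have h3 := mul_le_mul_of_nonneg_left h2 hδ.le
    rw [← mul_assoc, hgeom] at h3
    have h4 := mul_le_mul_of_nonneg_left (hS N) (pow_nonneg h0.le N)
    rw [habel]
    linarith
  have hsum : HasSum (fun n => δ ^ n * (x n - ε)) (∑' n, δ ^ n * x n - (1 - δ)⁻¹ * ε) := by
    simp only [mul_sub]
    exact (summable_discounted hB h0 h1).hasSum.sub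
      ((hasSum_geometric_of_lt_one h0.le h1).mul_right ε)
  have hlim := le_of_tendsto' hsum.tendsto_sum_nat hle
  have := mul_le_mul_of_nonneg_left hlim hδ.le
  rw [mul_sub, ← mul_assoc, mul_inv_cancel₀ hδ.ne'] at this
  linarith

end Discounting

/-! ### Boundedness of payoffs -/

section Bounds

variable {Ω M A : Type*} [Fintype Ω] [Fintype M] [Fintype A]

lemma abs_stagePayoff_le {μ : stdSimplex ℝ Ω} {Q : Ω → stdSimplex ℝ Ω} (hQ : ∀ ω, Q ω = μ)
    {u : Ω → A → ℝ} {B : ℝ} (hB : ∀ ω a, |u ω a| ≤ B) (σ : SenderStrategy Ω M)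
    (τ : ReceiverStrategy M A) (n : ℕ) : |stagePayoff u μ Q σ τ n| ≤ B := by
  obtain ⟨ρ, hρ⟩ := exists_isReduction μ σ
  rw [hρ.stagePayoff_eq hQ, abs_le]
  constructor
  · rw [← messageMean_const μ ρ n (-B)]
    exact messageMean_mono μ ρ n fun w => (abs_le.1 (abs_rulePayoff_le hB μ _ _)).1
  · conv_rhs => rw [← messageMean_const μ ρ n B]
    exact messageMean_mono μ ρ n fun w => (abs_le.1 (abs_rulePayoff_le hB μ _ _)).2

omit [Fintype Ω] [Fintype A] in
lemma exists_payoff_bound [Finite Ω] [Finite A] (u : Ω → A → ℝ) : ∃ B, ∀ ω a, |u ω a| ≤ B := by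
  obtain ⟨B, hB⟩ := (Set.finite_range fun p : Ω × A => |u p.1 p.2|).bddAbove
  exact ⟨B, fun ω a => hB ⟨(ω, a), rfl⟩⟩

end Bounds

/-! ### Uniform equilibrium payoffs lie in the hull -/

section UpperBound

variable {Ω M A : Type*} [Fintype Ω] [Fintype M] [Fintype A]

/-- Uniform equilibrium payoffs are convex combinations of equilibrium payoffs of the partial
commitment model. -/
lemma uniformEquilibriumPayoffs_subset {μ : stdSimplex ℝ Ω} {Q : Ω → stdSimplex ℝ Ω}
    (hQ : ∀ ω, Q ω = μ) (uS uR : Ω → A → ℝ) :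
    uniformEquilibriumPayoffs M uS uR μ Q ⊆
      convexHull ℝ (⋃ lam : stdSimplex ℝ M, equilibriumPayoffs uS uR μ lam) := by
  intro γ hγ
  by_contra hnot
  have hclosed := (isCompact_convexHull_of_finiteDimensional
    (isCompact_iUnion_equilibriumPayoffs (M := M) μ uS uR)).isClosed
  obtain ⟨f, c, hlt, hc⟩ := geometric_hahn_banach_closed_point (convex_convexHull ℝ _) hclosed hnot
  have hf : ∀ p : ℝ × ℝ, f p = p.1 * f (1, 0) + p.2 * f (0, 1) := by
    intro p
    have hp : p = p.1 • ((1, 0) : ℝ × ℝ) + p.2 • ((0, 1) : ℝ × ℝ) := by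
      ext <;> simp
    conv_lhs => rw [hp]
    simp only [map_add, map_smul, smul_eq_mul]
  set a := f (1, 0)
  set b := f (0, 1)
  obtain ⟨c', hcc', hc'⟩ := exists_between hc
  obtain ⟨K, hK, hgain⟩ := exists_gain_bound (M := M) μ uS uR
    (F := fun x => f (rulePayoff μ uS x.1 x.2, rulePayoff μ uR x.1 x.2))
    (f.continuous.comp ((continuous_rulePayoff μ uS).prodMk (continuous_rulePayoff μ uR))) hcc'
    fun x hx => (hlt _ (subset_convexHull ℝ _ (by
      rw [iUnion_equilibriumPayoffs]
      exact ⟨x.1, x.2, hx, rfl⟩))).le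
  -- The errors are `K * ε` for each player's incentives and `‖f‖ * ε` for the distance to `γ`; the
  -- extra `1` makes their total strictly less than `f γ - c'`.
  set ε := (f γ - c') / (2 * K + ‖f‖ + 1) with hε
  have hden : 0 < 2 * K + ‖f‖ + 1 := by positivity
  have hε0 : 0 < ε := div_pos (sub_pos.2 hc') hden
  obtain ⟨δ, hδ0, hδ1, σ, τ, hall⟩ := hγ ε hε0
  obtain ⟨hS, hR, hnear⟩ := hall δ le_rfl hδ1
  obtain ⟨ρ, hρ⟩ := exists_isReduction μ σ
  -- The static deviations, one per message history, are pasted into one dynamic deviation for each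
  -- player.
  choose ρ' κ' hlaw hbound using fun n w => hgain (ρ n w, receiverKernel τ n w)
  let ρs : MessageStrategy Ω M := ρ'
  let κs : ResponseStrategy M A := κ'
  have hprob : ∀ n w, messageProb μ ρs n w = messageProb μ ρ n w := messageProb_congr hlaw
  have hstage : ∀ n, a * stagePayoff uS μ Q σ τ n + b * stagePayoff uR μ Q σ τ n -
      K * ((stagePayoff uS μ Q ρs.toSender τ n - stagePayoff uS μ Q σ τ n) +
        (stagePayoff uR μ Q σ κs.toReceiver n - stagePayoff uR μ Q σ τ n)) ≤ c' := by
    intro n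
    rw [(isReduction_toSender μ ρs).stagePayoff_eq hQ]
    simp only [hρ.stagePayoff_eq hQ, receiverKernel_toReceiver]
    have hs : messageMean μ ρs n (fun w => rulePayoff μ uS (ρs n w) (receiverKernel τ n w)) =
        messageMean μ ρ n (fun w => rulePayoff μ uS (ρs n w) (receiverKernel τ n w)) := by
      simp only [messageMean, hprob]
    rw [hs]
    simp only [← messageMean_sub, ← messageMean_add, ← messageMean_const_mul]
    conv_rhs => rw [← messageMean_const μ ρ n c']
    refine messageMean_mono μ ρ n fun w => ?_
    have := hbound n w
    simp only [hf] at this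
    simp only [ρs, κs]
    linarith
  obtain ⟨BS, hBS⟩ := exists_payoff_bound uS
  obtain ⟨BR, hBR⟩ := exists_payoff_bound uR
  have hsumS := fun σ τ => (summable_discounted
    (abs_stagePayoff_le (M := M) hQ hBS σ τ) hδ0 hδ1).hasSum
  have hsumR := fun σ τ => (summable_discounted
    (abs_stagePayoff_le (M := M) hQ hBR σ τ) hδ0 hδ1).hasSum
  have hcomb := (((hsumS σ τ).mul_left a).add ((hsumR σ τ).mul_left b)).sub
    ((((hsumS ρs.toSender τ).sub (hsumS σ τ)).add
      ((hsumR σ κs.toReceiver).sub (hsumR σ τ))).mul_left K)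
  have hle := hasSum_le (fun n => ?_) hcomb
    ((hasSum_geometric_of_lt_one hδ0.le hδ1).mul_right c')
  swap
  · have := mul_le_mul_of_nonneg_left (hstage n) (pow_nonneg hδ0.le n)
    linarith
  have hδ : 0 < 1 - δ := sub_pos.2 hδ1
  have hle2 := mul_le_mul_of_nonneg_left hle hδ.le
  rw [← mul_assoc (1 - δ), mul_inv_cancel₀ hδ.ne', one_mul] at hle2
  have hdS := hS ρs.toSender
  have hdR := hR κs.toReceiver
  have hfn : f γ - f (discountedPayoff uS μ Q δ σ τ, discountedPayoff uR μ Q δ σ τ) ≤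
      ‖f‖ * ε := by
    rw [← map_sub]
    refine (le_abs_self _).trans ((f.le_opNorm _).trans ?_)
    rw [norm_sub_rev]
    exact mul_le_mul_of_nonneg_left hnear (norm_nonneg f)
  rw [hf (discountedPayoff uS μ Q δ σ τ, _)] at hfn
  have hKS := mul_le_mul_of_nonneg_left hdS hK
  have hKR := mul_le_mul_of_nonneg_left hdR hK
  have hεd : ε * (2 * K + ‖f‖ + 1) = f γ - c' := div_mul_cancel₀ _ hden.ne'
  simp only [discountedPayoff] at hfn hKS hKR
  linarith

end UpperBound

/-! ### Approximating a convex combination by averages -/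

section Scheduling

lemma abs_le_of_sq_le {a C L : ℝ} {T : ℕ} (hL : 0 < L) (h : a ^ 2 ≤ C * T) :
    |a| ≤ C / (2 * L) * T + L / 2 := by
  have h1 : 0 ≤ (|a| - L) ^ 2 := sq_nonneg _
  rw [sub_sq, sq_abs] at h1
  have h2 : |a| * (2 * L) ≤ C * T + L ^ 2 := by linarith
  rw [← le_div_iff₀ (by positivity)] at h2
  refine h2.trans_eq ?_
  field_simp

/-- A point of the convex hull of a finite set is approached by the averages of a sequence in
this set. -/
lemma exists_schedule {t : Finset (ℝ × ℝ)} {γ : ℝ × ℝ} (hγ : γ ∈ convexHull ℝ (t : Set (ℝ × ℝ)))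
    {ε : ℝ} (hε : 0 < ε) :
    ∃ (j : ℕ → t) (K : ℝ), ∀ T : ℕ,
      |∑ k ∈ Finset.range T, (((j k).1).1 - γ.1)| ≤ ε * T + K ∧
      |∑ k ∈ Finset.range T, (((j k).1).2 - γ.2)| ≤ ε * T + K := by
  have hpick : ∀ s : ℝ × ℝ, ∃ e : t, s.1 * (e.1.1 - γ.1) + s.2 * (e.1.2 - γ.2) ≤ 0 := by
    intro s
    by_contra! hcon
    have hsub : (t : Set (ℝ × ℝ)) ⊆ {p | 0 < s.1 * (p.1 - γ.1) + s.2 * (p.2 - γ.2)} :=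
      fun p hp => hcon ⟨p, hp⟩
    have hconv : Convex ℝ {p : ℝ × ℝ | 0 < s.1 * (p.1 - γ.1) + s.2 * (p.2 - γ.2)} := by
      intro p hp q hq a b ha hb hab
      simp only [Set.mem_ofPred_eq, Prod.fst_add, Prod.smul_fst, Prod.snd_add, Prod.smul_snd,
        smul_eq_mul] at hp hq ⊢
      have : s.1 * (a * p.1 + b * q.1 - γ.1) + s.2 * (a * p.2 + b * q.2 - γ.2) =
          a * (s.1 * (p.1 - γ.1) + s.2 * (p.2 - γ.2)) +
          b * (s.1 * (q.1 - γ.1) + s.2 * (q.2 - γ.2)) := by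
        obtain rfl : b = 1 - a := by linarith
        ring
      rw [this]
      rcases ha.eq_or_lt with rfl | ha
      · obtain rfl : b = 1 := by linarith
        linarith
      · have := mul_pos ha hp
        have := mul_nonneg hb hq.le
        linarith
    have := convexHull_min hsub hconv hγ
    simp at this
  choose pick hpick using hpick
  -- Greedy choice: each increment has nonpositive inner product with the accumulated error, so the
  -- squared error grows by at most `C` per step and the error is of order `√T`.
  let S : ℕ → ℝ × ℝ := fun n => Nat.rec 0 (fun _ s => s + ((pick s).1 - γ)) n
  have hS : ∀ n, S (n + 1) = S n + ((pick (S n)).1 - γ) := fun n => rfl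
  obtain ⟨C, hC⟩ := (Set.finite_range fun e : t =>
    (e.1.1 - γ.1) ^ 2 + (e.1.2 - γ.2) ^ 2).bddAbove
  have hC' : ∀ e : t, (e.1.1 - γ.1) ^ 2 + (e.1.2 - γ.2) ^ 2 ≤ C := fun e => hC ⟨e, rfl⟩
  have hsq : ∀ T : ℕ, (S T).1 ^ 2 + (S T).2 ^ 2 ≤ C * T := by
    intro T
    induction T with
    | zero => simp [S]
    | succ T ih =>
      have h1 := hpick (S T)
      have h2 := hC' (pick (S T))
      simp only [hS, Prod.fst_add, Prod.snd_add, Prod.fst_sub, Prod.snd_sub, Nat.cast_add,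
        Nat.cast_one]
      linarith
  have hsum1 : ∀ T, ∑ k ∈ Finset.range T, ((pick (S k)).1.1 - γ.1) = (S T).1 := by
    intro T
    induction T with
    | zero => simp [S]
    | succ T ih => rw [Finset.sum_range_succ, ih, hS]; rfl
  have hsum2 : ∀ T, ∑ k ∈ Finset.range T, ((pick (S k)).1.2 - γ.2) = (S T).2 := by
    intro T
    induction T with
    | zero => simp [S]
    | succ T ih => rw [Finset.sum_range_succ, ih, hS]; rfl
  have hC0 : 0 ≤ C := (add_nonneg (sq_nonneg _) (sq_nonneg _)).trans (hC' (pick 0))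
  have hL : 0 < (C + 1) / (2 * ε) := by positivity
  have hLε : C / (2 * ((C + 1) / (2 * ε))) ≤ ε := by
    rw [div_le_iff₀ (by positivity)]
    have : ε * (2 * ((C + 1) / (2 * ε))) = C + 1 := by field_simp
    linarith
  refine ⟨fun n => pick (S n), (C + 1) / (2 * ε) / 2, fun T => ?_⟩
  have hT : C / (2 * ((C + 1) / (2 * ε))) * T ≤ ε * T :=
    mul_le_mul_of_nonneg_right hLε (Nat.cast_nonneg T)
  rw [hsum1, hsum2]
  constructor
  · have := abs_le_of_sq_le hL ((le_add_of_nonneg_right (sq_nonneg _)).trans (hsq T))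
    linarith
  · have := abs_le_of_sq_le hL ((le_add_of_nonneg_left (sq_nonneg _)).trans (hsq T))
    linarith

end Scheduling

/-! ### The receiver's statistical test -/

section Test

open Classical in
/-- The message that replaces `m` when the current score is `s`: a costly message is replaced by
a cheap one when the score is positive. -/
noncomputable def replacement {M : Type*} (θ : M → ℝ) (m₀ : M) (s : ℝ) (m : M) : M :=
  if 0 < s ∧ 0 < θ m then m₀ else m

open Classical in
/-- The indicator that the message `m` is replaced when the current score is `s`. -/
noncomputable def isReplaced {M : Type*} (θ : M → ℝ) (s : ℝ) (m : M) : ℝ :=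
  if 0 < s ∧ 0 < θ m then 1 else 0

/-- The cumulated cost of the messages after replacements. -/
noncomputable def score {M : Type*} (θ : ℕ → M → ℝ) (m₀ : ℕ → M) : (n : ℕ) → (Fin n → M) → ℝ
  | 0, _ => 0
  | n + 1, w => score θ m₀ n (fun k => w k.castSucc) + θ n (replacement (θ n) (m₀ n)
      (score θ m₀ n (fun k => w k.castSucc)) (w (Fin.last n)))

lemma score_snoc {M : Type*} (θ : ℕ → M → ℝ) (m₀ : ℕ → M) (n : ℕ) (w : Fin n → M) (m : M) :
    score θ m₀ (n + 1) (Fin.snoc (α := fun _ => M) w m) =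
      score θ m₀ n w + θ n (replacement (θ n) (m₀ n) (score θ m₀ n w) m) := by
  simp only [score, Fin.snoc_castSucc, Fin.snoc_last]

/-- A positive score cannot increase, and a nonpositive one rises by at most `C`. -/
lemma score_le {M : Type*} {θ : ℕ → M → ℝ} {m₀ : ℕ → M} (h₀ : ∀ n, θ n (m₀ n) ≤ 0) {C : ℝ}
    (hC0 : 0 ≤ C) (hC : ∀ n m, |θ n m| ≤ C) (n : ℕ) (w : Fin n → M) : score θ m₀ n w ≤ C := by
  induction n with
  | zero => exact hC0
  | succ n ih =>
    have hs := ih fun k => w k.castSucc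
    rw [score]
    unfold replacement
    split_ifs with h
    · linarith [h₀ n]
    · rcases not_and_or.1 h with h | h
      · linarith [(abs_le.1 (hC n (w (Fin.last n)))).2]
      · linarith

variable {Ω M A : Type*} [Fintype Ω] [Fintype M] [Fintype A]

open Classical in
/-- The messaging rule that applies `r` to the messages of `ρ`. -/
noncomputable def mapRule (r : M → M) (ρ : Ω → stdSimplex ℝ M) : Ω → stdSimplex ℝ M := fun ω =>
  ⟨fun m' => ∑ m, if r m = m' then (ρ ω).1 m else 0, fun m' =>
    Finset.sum_nonneg fun m _ => by
      split_ifs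
      exacts [(ρ ω).2.1 m, le_rfl], by
    rw [Finset.sum_comm]
    simp [(ρ ω).2.2]⟩

lemma expect_mapRule (μ : stdSimplex ℝ Ω) (r : M → M) (ρ : Ω → stdSimplex ℝ M)
    (c : Ω → M → ℝ) : expect μ (mapRule r ρ) c = expect μ ρ fun ω m => c ω (r m) := by
  classical
  simp only [expect, mapRule]
  refine Finset.sum_congr rfl fun ω _ => ?_
  congr 1
  simp only [Finset.sum_mul]
  rw [Finset.sum_comm]
  refine Finset.sum_congr rfl fun m _ => ?_
  simp [ite_mul]

/-- The response rules that correct the messages according to the score. -/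
noncomputable def correctedResponse (θ : ℕ → M → ℝ) (m₀ : ℕ → M) (κ : ℕ → M → stdSimplex ℝ A) :
    ResponseStrategy M A :=
  fun n w m => κ n (replacement (θ n) (m₀ n) (score θ m₀ n w) m)

/-- Whatever the message strategy, the cumulated payoff of the sender against the corrected
response rules exceeds the static payoffs by a bounded amount. -/
lemma sum_stage_le_of_corrected {μ : stdSimplex ℝ Ω} {uS : Ω → A → ℝ} {θ : ℕ → M → ℝ}
    {m₀ : ℕ → M} (h₀ : ∀ n, θ n (m₀ n) ≤ 0) {C : ℝ} (hC0 : 0 ≤ C) (hC : ∀ n m, |θ n m| ≤ C)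
    {κ : ℕ → M → stdSimplex ℝ A} {v : ℕ → ℝ} {η : ℝ}
    (hv : ∀ n ρ', rulePayoff μ uS ρ' (κ n) ≤ v n + η + expect μ ρ' fun _ m => θ n m)
    (ρ : MessageStrategy Ω M) (T : ℕ) :
    ∑ n ∈ Finset.range T, messageMean μ ρ n (fun w =>
        rulePayoff μ uS (ρ n w) (correctedResponse θ m₀ κ n w)) ≤
      ∑ n ∈ Finset.range T, v n + η * T + C := by
  have key : ∑ n ∈ Finset.range T, messageMean μ ρ n (fun w =>
        rulePayoff μ uS (ρ n w) (correctedResponse θ m₀ κ n w)) ≤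
      ∑ n ∈ Finset.range T, v n + η * T + messageMean μ ρ T (score θ m₀ T) := by
    induction T with
    | zero => simp [messageMean_zero, score]
    | succ T ih =>
      have hstep : messageMean μ ρ T (fun w =>
          rulePayoff μ uS (ρ T w) (correctedResponse θ m₀ κ T w)) ≤
          v T + η + (messageMean μ ρ (T + 1) (score θ m₀ (T + 1)) -
            messageMean μ ρ T (score θ m₀ T)) := by
        rw [messageMean_succ, ← messageMean_sub]
        conv_rhs => rw [← messageMean_const μ ρ T (v T + η)]
        rw [← messageMean_add]
        refine messageMean_mono μ ρ T fun w => ?_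
        -- The price inequality is applied to the messages as corrected by the receiver; their
        -- expected price is exactly the increment of the score, so the sum telescopes.
        have := hv T (mapRule (replacement (θ T) (m₀ T) (score θ m₀ T w)) (ρ T w))
        rw [rulePayoff, expect_mapRule, expect_mapRule] at this
        simp only [score_snoc, expect_add, expect_const]
        rw [add_sub_cancel_left]
        exact this
      rw [Finset.sum_range_succ, Finset.sum_range_succ]
      push_cast
      linarith
  have hle : messageMean μ ρ T (score θ m₀ T) ≤ C := by
    conv_rhs => rw [← messageMean_const μ ρ T C]
    exact messageMean_mono μ ρ T fun w => score_le h₀ hC0 hC T w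
  linarith

/-- The message strategy that plays `ρ n` in period `n`, whatever the past. -/
def constStrategy (ρ : ℕ → Ω → stdSimplex ℝ M) : MessageStrategy Ω M := fun n _ => ρ n

/-- Under the prescribed messaging rules, replacements are rare. -/
lemma sum_isReplaced_le {μ : stdSimplex ℝ Ω} {θ : ℕ → M → ℝ}
    {m₀ : ℕ → M} (h₀ : ∀ n, θ n (m₀ n) ≤ 0) {C : ℝ} (hC : ∀ n m, |θ n m| ≤ C)
    {g : ℝ} (hg : 0 < g) (hgθ : ∀ n m, 0 < θ n m → g ≤ θ n m) {ρ : ℕ → Ω → stdSimplex ℝ M}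
    (hρ : ∀ n, expect μ (ρ n) (fun _ m => θ n m) = 0) {ε : ℝ} (hε : 0 < ε) :
    ∃ K : ℝ, ∀ T : ℕ, ∑ n ∈ Finset.range T, messageMean μ (constStrategy ρ) n (fun w =>
      expect μ (ρ n) fun _ m => isReplaced (θ n) (score θ m₀ n w) m) ≤ ε * T + K := by
  have hsq : ∀ T : ℕ, messageMean μ (constStrategy ρ) T (fun w => score θ m₀ T w ^ 2) ≤
      C ^ 2 * T := by
    intro T
    induction T with
    | zero => simp [messageMean_zero, score]
    | succ T ih =>
      rw [messageMean_succ]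
      have : messageMean μ (constStrategy ρ) T (fun w => expect μ (constStrategy ρ T w)
          fun _ m => score θ m₀ (T + 1) (Fin.snoc (α := fun _ => M) w m) ^ 2) ≤
          messageMean μ (constStrategy ρ) T (fun w => score θ m₀ T w ^ 2 + C ^ 2) := by
        refine messageMean_mono μ _ T fun w => ?_
        simp only [score_snoc, constStrategy]
        calc _ ≤ expect μ (ρ T) (fun _ m => (score θ m₀ T w ^ 2 + C ^ 2) +
              2 * score θ m₀ T w * θ T m) := by
              refine expect_mono μ _ fun _ m => ?_
              generalize score θ m₀ T w = s
              -- A replacement occurs only for `s > 0` and lowers the price, so it can only reduce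
              -- the cross term, which has mean zero without replacement.
              have h1 : s * θ T (replacement (θ T) (m₀ T) s m) ≤ s * θ T m := by
                unfold replacement
                split_ifs with h
                · exact mul_le_mul_of_nonneg_left ((h₀ T).trans h.2.le) h.1.le
                · exact le_rfl
              have h2 := sq_le_sq' (abs_le.1 (hC T (replacement (θ T) (m₀ T) s m))).1
                (abs_le.1 (hC T (replacement (θ T) (m₀ T) s m))).2
              nlinarith
          _ = _ := by rw [expect_add, expect_const, expect_const_mul, hρ, mul_zero, add_zero]
      rw [messageMean_add, messageMean_const] at this
      push_cast
      linarith
  -- Prices are centered, and each replacement lowers the score by at least `g`; many replacements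
  -- would make the mean score very negative, against the second-moment bound.
  have hdrift : ∀ T : ℕ, g * ∑ n ∈ Finset.range T, messageMean μ (constStrategy ρ) n (fun w =>
      expect μ (ρ n) fun _ m => isReplaced (θ n) (score θ m₀ n w) m) ≤
      messageMean μ (constStrategy ρ) T (fun w => -1 * score θ m₀ T w) := by
    intro T
    induction T with
    | zero => simp [messageMean_zero, score]
    | succ T ih =>
      rw [Finset.sum_range_succ, mul_add, messageMean_succ, ← messageMean_const_mul]
      refine (add_le_add_left ih _).trans ?_
      rw [← messageMean_add]
      refine messageMean_mono μ _ T fun w => ?_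
      simp only [score_snoc, constStrategy]
      calc _ = expect μ (ρ T) (fun _ m => -1 * score θ m₀ T w +
            (g * isReplaced (θ T) (score θ m₀ T w) m - θ T m)) := by
            rw [expect_add, expect_const, expect_sub, expect_const_mul, hρ, sub_zero]
        _ ≤ _ := by
            refine expect_mono μ _ fun _ m => ?_
            unfold isReplaced replacement
            split_ifs with h
            · linarith [h₀ T, hgθ T m h.2]
            · linarith
  have hL : 0 < (C ^ 2 + 1) / (2 * (g * ε)) := by positivity
  set L := (C ^ 2 + 1) / (2 * (g * ε)) with hLdef
  have hLε : C ^ 2 / (2 * L) ≤ g * ε := by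
    rw [div_le_iff₀ (by positivity)]
    have : g * ε * (2 * L) = C ^ 2 + 1 := by rw [hLdef]; field_simp
    linarith
  refine ⟨L / 2 / g, fun T => ?_⟩
  have h1 : messageMean μ (constStrategy ρ) T (fun w => -1 * score θ m₀ T w) ≤
      1 / (2 * L) * messageMean μ (constStrategy ρ) T (fun w => score θ m₀ T w ^ 2) + L / 2 := by
    rw [← messageMean_const_mul]
    conv_rhs => rw [← messageMean_const μ (constStrategy ρ) T (L / 2)]
    rw [← messageMean_add]
    refine messageMean_mono μ _ T fun w => ?_
    generalize score θ m₀ T w = s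
    have h2 : 1 / (2 * L) * s ^ 2 + L / 2 - -1 * s = (s + L) ^ 2 / (2 * L) := by
      field_simp
      ring
    have h3 : 0 ≤ (s + L) ^ 2 / (2 * L) := by positivity
    linarith
  have h4 := mul_le_mul_of_nonneg_left (hsq T) (show 0 ≤ 1 / (2 * L) by positivity)
  have h5 := mul_le_mul_of_nonneg_right hLε (Nat.cast_nonneg (α := ℝ) T)
  have h6 : 1 / (2 * L) * (C ^ 2 * T) = C ^ 2 / (2 * L) * T := by ring
  refine le_of_mul_le_mul_left ?_ hg
  have h7 : g * (ε * T + L / 2 / g) = g * ε * T + L / 2 := by field_simp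
  rw [h7]
  linarith [hdrift T]

/-- Under the prescribed messaging rules, correcting the messages changes the stage payoff by at
most the probability of a replacement. -/
lemma abs_stage_sub_le {μ : stdSimplex ℝ Ω} {u : Ω → A → ℝ} {B : ℝ} (hB : ∀ ω a, |u ω a| ≤ B)
    (θ : ℕ → M → ℝ) (m₀ : ℕ → M) (ρ : ℕ → Ω → stdSimplex ℝ M) (κ : ℕ → M → stdSimplex ℝ A)
    (n : ℕ) :
    |messageMean μ (constStrategy ρ) n (fun w =>
        rulePayoff μ u (ρ n) (correctedResponse θ m₀ κ n w)) - rulePayoff μ u (ρ n) (κ n)| ≤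
      2 * B * messageMean μ (constStrategy ρ) n (fun w =>
        expect μ (ρ n) fun _ m => isReplaced (θ n) (score θ m₀ n w) m) := by
  have hpt : ∀ w ω m, |meanAction u (correctedResponse θ m₀ κ n w) ω m - meanAction u (κ n) ω m| ≤
      2 * B * isReplaced (θ n) (score θ m₀ n w) m := by
    intro w ω m
    change |meanAction u (κ n) ω (replacement (θ n) (m₀ n) (score θ m₀ n w) m) - _| ≤ _
    unfold replacement isReplaced
    split_ifs
    · have h1 := abs_le.1 (abs_meanAction_le hB (κ n) ω (m₀ n))
      have h2 := abs_le.1 (abs_meanAction_le hB (κ n) ω m)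
      rw [abs_le]
      constructor <;> linarith [h1.1, h1.2, h2.1, h2.2]
    · simp
  rw [← messageMean_const μ (constStrategy ρ) n (rulePayoff μ u (ρ n) (κ n)), ← messageMean_sub,
    ← messageMean_const_mul, abs_le, neg_eq_neg_one_mul, ← messageMean_const_mul]
  simp only [rulePayoff, ← expect_sub, ← expect_const_mul]
  constructor
  · refine messageMean_mono μ _ n fun w => expect_mono μ _ fun ω m => ?_
    linarith [(abs_le.1 (hpt w ω m)).1]
  · exact messageMean_mono μ _ n fun w => expect_mono μ _ fun ω m => (abs_le.1 (hpt w ω m)).2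

end Test

/-! ### The hull consists of uniform equilibrium payoffs -/

section LowerBound

variable {Ω M A : Type*} [Fintype Ω] [Fintype M] [Fintype A]

/-- Centered approximate prices of messages. -/
lemma exists_centered_price {μ : stdSimplex ℝ Ω} {uS uR : Ω → A → ℝ} {ρ : Ω → stdSimplex ℝ M}
    {κ : M → stdSimplex ℝ A} (h : IsRuleEquilibrium μ uS uR ρ κ) {η : ℝ} (hη : 0 < η) :
    ∃ θ : M → ℝ, expect μ ρ (fun _ m => θ m) = 0 ∧ ∀ ρ' : Ω → stdSimplex ℝ M,
      rulePayoff μ uS ρ' κ ≤ rulePayoff μ uS ρ κ + η + expect μ ρ' fun _ m => θ m := by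
  obtain ⟨ψ, hψ⟩ := exists_price h hη
  refine ⟨fun m => ψ m - ∑ m, messageLaw μ ρ m * ψ m, ?_, fun ρ' => ?_⟩
  · rw [expect_sub, expect_const, expect_message, sub_self]
  · rw [expect_sub, expect_const, expect_message]
    linarith [hψ ρ']

lemma exists_nonpos_of_expect_eq_zero {μ : stdSimplex ℝ Ω} {ρ : Ω → stdSimplex ℝ M} {θ : M → ℝ}
    (h : expect μ ρ (fun _ m => θ m) = 0) : ∃ m, θ m ≤ 0 := by
  by_contra! hpos
  rw [expect_message, Finset.sum_eq_zero_iff_of_nonneg fun m _ =>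
    mul_nonneg (messageLaw_nonneg μ ρ m) (hpos m).le] at h
  have := sum_messageLaw μ ρ
  rw [Finset.sum_eq_zero fun m hm => (mul_eq_zero.1 (h m hm)).resolve_right (hpos m).ne'] at this
  exact zero_ne_one this

lemma exists_pos_le_of_pos {ι : Type*} [Finite ι] (f : ι → ℝ) :
    ∃ g > 0, ∀ i, 0 < f i → g ≤ f i := by
  obtain ⟨B, hB⟩ := (Set.finite_range fun i => (f i)⁻¹).bddAbove
  refine ⟨(max B 1)⁻¹, by positivity, fun i hi => ?_⟩
  rw [inv_le_comm₀ (by positivity) hi]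
  exact (hB ⟨i, rfl⟩).trans (le_max_left _ _)

/-- A schedule of equilibria of the partial commitment model can be sustained in the dynamic
game, up to a small average error. -/
lemma exists_profile_of_schedule {J : Type*} [Finite J] {μ : stdSimplex ℝ Ω}
    {Q : Ω → stdSimplex ℝ Ω} (hQ : ∀ ω, Q ω = μ) {uS uR : Ω → A → ℝ}
    {ρ : J → Ω → stdSimplex ℝ M} {κ : J → M → stdSimplex ℝ A}
    (heq : ∀ i, IsRuleEquilibrium μ uS uR (ρ i) (κ i)) (j : ℕ → J) {ε : ℝ} (hε : 0 < ε) :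
    ∃ (σ : SenderStrategy Ω M) (τ : ReceiverStrategy M A) (K : ℝ),
      (∀ σ' (T : ℕ), ∑ n ∈ Finset.range T, stagePayoff uS μ Q σ' τ n ≤
        ∑ n ∈ Finset.range T, rulePayoff μ uS (ρ (j n)) (κ (j n)) + ε * T + K) ∧
      (∀ τ' n, stagePayoff uR μ Q σ τ' n ≤ rulePayoff μ uR (ρ (j n)) (κ (j n))) ∧
      ∀ u, (u = uS ∨ u = uR) → ∀ T : ℕ, |∑ n ∈ Finset.range T, stagePayoff u μ Q σ τ n -
        ∑ n ∈ Finset.range T, rulePayoff μ u (ρ (j n)) (κ (j n))| ≤ ε * T + K := by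
  choose θ hθ hprice using fun i => exists_centered_price (heq i) hε
  choose m₀ hm₀ using fun i => exists_nonpos_of_expect_eq_zero (hθ i)
  obtain ⟨C, hC⟩ := exists_payoff_bound θ
  obtain ⟨g, hg, hgθ⟩ := exists_pos_le_of_pos fun p : J × M => θ p.1 p.2
  obtain ⟨BS, hBS⟩ := exists_payoff_bound uS
  obtain ⟨BR, hBR⟩ := exists_payoff_bound uR
  set B := max 1 (max BS BR) with hBdef
  have hB0 : 0 < B := zero_lt_one.trans_le (le_max_left _ _)
  have hB : ∀ u, (u = uS ∨ u = uR) → ∀ ω a, |u ω a| ≤ B := by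
    rintro u (rfl | rfl) ω a
    · exact (hBS ω a).trans ((le_max_left _ _).trans (le_max_right _ _))
    · exact (hBR ω a).trans ((le_max_right _ _).trans (le_max_right _ _))
  obtain ⟨K, hK⟩ := sum_isReplaced_le (θ := fun n => θ (j n)) (m₀ := fun n => m₀ (j n))
    (fun n => hm₀ (j n)) (fun n m => hC (j n) m) hg (fun n m => hgθ (j n, m))
    (ρ := fun n => ρ (j n)) (fun n => hθ (j n)) (show 0 < ε / (2 * B) by positivity)
  set τ₀ := correctedResponse (fun n => θ (j n)) (fun n => m₀ (j n)) (fun n => κ (j n))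
  have hC0 : ∀ i, 0 ≤ C := fun i => (abs_nonneg _).trans (hC i (m₀ i))
  -- `C` bounds the score and serves against deviations of the sender; `2 * B * K` is the payoff
  -- cost of the replacements under the prescribed play.
  refine ⟨(constStrategy fun n => ρ (j n)).toSender, τ₀.toReceiver, max C (2 * B * K),
    fun σ' T => ?_, fun τ' n => ?_, fun u hu T => ?_⟩
  · obtain ⟨ρ', hρ'⟩ := exists_isReduction μ σ'
    simp only [hρ'.stagePayoff_eq hQ, receiverKernel_toReceiver]
    refine (sum_stage_le_of_corrected (fun n => hm₀ (j n)) (hC0 (j 0)) (fun n m => hC (j n) m)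
      (fun n => hprice (j n)) ρ' T).trans ?_
    linarith [le_max_left C (2 * B * K)]
  · rw [(isReduction_toSender μ _).stagePayoff_eq hQ]
    conv_rhs => rw [← messageMean_const μ (constStrategy fun n => ρ (j n)) n
      (rulePayoff μ uR (ρ (j n)) (κ (j n)))]
    -- The prescribed sender ignores the past, so in each period the receiver faces only the static
    -- problem.
    exact messageMean_mono μ _ n fun w => (heq (j n)).2 _
  · rw [← Finset.sum_sub_distrib]
    refine (Finset.abs_sum_le_sum_abs _ _).trans ?_
    have h1 := Finset.sum_le_sum fun n (_ : n ∈ Finset.range T) => abs_stage_sub_le (μ := μ) (hB u hu)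
      (fun n => θ (j n)) (fun n => m₀ (j n)) (fun n => ρ (j n)) (fun n => κ (j n)) n
    rw [← Finset.mul_sum] at h1
    have h2 := mul_le_mul_of_nonneg_left (hK T) (show 0 ≤ 2 * B by positivity)
    have h3 : 2 * B * (ε / (2 * B) * T + K) = ε * T + 2 * B * K := by field_simp
    rw [h3] at h2
    simp only [stagePayoff_toSender_toReceiver hQ]
    exact (h1.trans h2).trans (by linarith [le_max_right C (2 * B * K)])

/-- Convex combinations of equilibrium payoffs of the partial commitment model are uniform
equilibrium payoffs. -/
lemma convexHull_subset_uniformEquilibriumPayoffs {μ : stdSimplex ℝ Ω} {Q : Ω → stdSimplex ℝ Ω}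
    (hQ : ∀ ω, Q ω = μ) (uS uR : Ω → A → ℝ) :
    convexHull ℝ (⋃ lam : stdSimplex ℝ M, equilibriumPayoffs uS uR μ lam) ⊆
      uniformEquilibriumPayoffs M uS uR μ Q := by
  intro γ hγ ε hε
  rw [convexHull_eq_union_convexHull_finite_subsets] at hγ
  simp only [Set.mem_iUnion] at hγ
  obtain ⟨t, ht, hγ⟩ := hγ
  rw [iUnion_equilibriumPayoffs] at ht
  choose ρ κ heq hpay using fun e : t => ht e.2
  -- The schedule and the play contribute `ε / 8` each, and `(1 - δ) * K` at most `ε / 4`. Deviation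
  -- payoffs then exceed `γ` by at most `ε / 2` and equilibrium payoffs fall short of it by at most
  -- `ε / 2`.
  have hε8 : 0 < ε / 8 := by positivity
  obtain ⟨j, K₁, hj⟩ := exists_schedule hγ hε8
  obtain ⟨σ, τ, K₂, hS, hR, hnear⟩ := exists_profile_of_schedule hQ heq j hε8
  have hS1 : ∀ n, rulePayoff μ uS (ρ (j n)) (κ (j n)) = (j n).1.1 := fun n => by rw [hpay (j n)]
  have hR1 : ∀ n, rulePayoff μ uR (ρ (j n)) (κ (j n)) = (j n).1.2 := fun n => by rw [hpay (j n)]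
  simp only [hR1] at hR
  simp only [hS1] at hS
  have hnearS := hnear uS (Or.inl rfl)
  have hnearR := hnear uR (Or.inr rfl)
  simp only [hS1] at hnearS
  simp only [hR1] at hnearR
  simp only [Finset.sum_sub_distrib, Finset.sum_const, Finset.card_range, nsmul_eq_mul, abs_le]
    at hj hnearS hnearR
  obtain ⟨BS, hBS⟩ := exists_payoff_bound uS
  obtain ⟨BR, hBR⟩ := exists_payoff_bound uR
  set K := |K₁| + |K₂| with hKdef
  have hK0 : 0 ≤ K := by positivity
  have hK1 : K₁ ≤ |K₁| := le_abs_self _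
  have hK2 : K₂ ≤ |K₂| := le_abs_self _
  have hK1' : 0 ≤ |K₁| := abs_nonneg _
  have hK2' : 0 ≤ |K₂| := abs_nonneg _
  refine ⟨max (1 / 2) (1 - ε / (4 * (K + 1))), lt_max_of_lt_left one_half_pos,
    max_lt one_half_lt_one (sub_lt_self _ (by positivity)), σ, τ, fun δ hδ hδ1 => ?_⟩
  have hδ0 : 0 < δ := one_half_pos.trans_le ((le_max_left _ _).trans hδ)
  have hδK : (1 - δ) * K ≤ ε / 4 := by
    have h1 : 1 - δ ≤ ε / (4 * (K + 1)) := by linarith [(le_max_right _ _).trans hδ]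
    have h2 := mul_le_mul_of_nonneg_right h1 hK0
    refine h2.trans ?_
    rw [div_mul_eq_mul_div, div_le_div_iff₀ (by positivity) (by positivity)]
    nlinarith
  have hupS : ∀ σ', discountedPayoff uS μ Q δ σ' τ ≤ γ.1 + ε / 4 + (1 - δ) * K := fun σ' =>
    discounted_le_of_sum_le (abs_stagePayoff_le hQ hBS σ' τ)
      (fun T => by linarith [hS σ' T, (hj T).1.2]) hδ0 hδ1
  have hupR : ∀ τ', discountedPayoff uR μ Q δ σ τ' ≤ γ.2 + ε / 4 + (1 - δ) * K := fun τ' =>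
    discounted_le_of_sum_le (abs_stagePayoff_le hQ hBR σ τ')
      (fun T => by
        have := Finset.sum_le_sum fun n (_ : n ∈ Finset.range T) => hR τ' n
        have hT : 0 ≤ ε * (T : ℝ) := by positivity
        linarith [(hj T).2.2]) hδ0 hδ1
  have hlowS : γ.1 - ε / 4 - (1 - δ) * K ≤ discountedPayoff uS μ Q δ σ τ := by
    have := discounted_le_of_sum_le (x := fun n => -stagePayoff uS μ Q σ τ n)
      (ε := -γ.1 + ε / 4) (K := K)
      (fun n => by rw [abs_neg]; exact abs_stagePayoff_le hQ hBS σ τ n)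
      (fun T => by
        rw [Finset.sum_neg_distrib]
        linarith [(hj T).1.1, (hnearS T).1]) hδ0 hδ1
    simp only [mul_neg, tsum_neg] at this
    rw [discountedPayoff]
    linarith
  have hlowR : γ.2 - ε / 4 - (1 - δ) * K ≤ discountedPayoff uR μ Q δ σ τ := by
    have := discounted_le_of_sum_le (x := fun n => -stagePayoff uR μ Q σ τ n)
      (ε := -γ.2 + ε / 4) (K := K)
      (fun n => by rw [abs_neg]; exact abs_stagePayoff_le hQ hBR σ τ n)
      (fun T => by
        rw [Finset.sum_neg_distrib]
        linarith [(hj T).2.1, (hnearR T).1]) hδ0 hδ1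
    simp only [mul_neg, tsum_neg] at this
    rw [discountedPayoff]
    linarith
  refine ⟨fun σ' => by linarith [hupS σ'], fun τ' => by linarith [hupR τ'], ?_⟩
  rw [Prod.norm_def, max_le_iff]
  simp only [Prod.fst_sub, Prod.snd_sub, Real.norm_eq_abs, abs_le]
  refine ⟨⟨?_, ?_⟩, ?_, ?_⟩ <;> linarith [hupS σ, hupR τ]

end LowerBound

end Persuasion

theorem proposition2 {Ω M A : Type*} [Fintype Ω] [Fintype M] [Fintype A]
    (hM : min (Fintype.card Ω) (Fintype.card A) ≤ Fintype.card M)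
    (uS uR : Ω → A → ℝ) (μ : stdSimplex ℝ Ω)
    (Q : Ω → stdSimplex ℝ Ω) (hQ : ∀ ω : Ω, Q ω = μ) :
    Persuasion.uniformEquilibriumPayoffs M uS uR μ Q =
      convexHull ℝ (⋃ lam : stdSimplex ℝ M, Persuasion.equilibriumPayoffs uS uR μ lam) :=
  Set.Subset.antisymm (Persuasion.uniformEquilibriumPayoffs_subset hQ uS uR)
    (Persuasion.convexHull_subset_uniformEquilibriumPayoffs hQ uS uR)
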